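/- **Setting: programs.** Let $\mathcal X,\mathcal G$ be sets of local and global variables, $\mathcal V$ a set of values containing the set $\mathcal I$ of thread ids (with $0\in\mathcal I$ the initial id), $\mathsf M$ a finite set of mutexes with a mutex $m_g$ for every $g\in\mathcal G$, $\mathcal N$ a set of program points with start point $u_0$, and $\mathcal E$ a set of control-flow edges $(u,A,u')$, where $A$ is a guard on locals, an assignment $x=r$ to a local, $x=\mathsf{create}(u_1)$, $\mathsf{lock}(a)$, $\mathsf{unlock}(a)$, a read $x=g$ or a write $g=x$. A distinguished local $\mathsf{self}$ holds the thread id and is never assigned explicitly, at each program point at most one edge creates a thread, and each access $A$ to $g$ occurs as $\mathsf{lock}(m_g);A;\mathsf{unlock}(m_g)$. **Local traces.** A global trace consists of one finite raw execution $\bar u_0a_1\bar u_1\dots a_n\bar u_n$ along control-flow edges for each thread id in some set, with nodes $\bar u_j=(j,u_j,\sigma_j)$, a create order $\to_c$ from creating nodes to the first nodes of created threads, and for every mutex $a$ a locking order $\to_a$ that assigns to every $\mathsf{lock}(a)$ exactly one preceding $\mathsf{unlock}(a)$ (or the root), each of these being followed by at most one $\mathsf{lock}(a)$. Every thread other than the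 initial one is created exactly once, with the local state of its creator except for $\mathsf{self}$. The causality order, generated by the program order, $\to_c$ and all $\to_a$, is a partial order with the initial node of thread $0$ as least element. Mutexes are not re-entrant and are released only while held, and every read of $g$ returns the value of the maximal write to $g$ that precedes it. A local trace is a global trace with a greatest node, its sink; the thread of the sink is the ego thread. $\mathsf{loc}(t)$ is the program point of the sink, and $L_t[\bar u]$ is the set of mutexes held by the thread of $\bar u$ at $\bar u$. $\mathsf{init}$ consists of the one-node traces at $u_0$ with $\mathsf{self}=0$ and arbitrary other locals. For an edge $e=(u,A,u')$ the operation $[\![e]\!]$ prolongs the ego thread of a local trace at $u$ by $A$; for $A=\mathsf{lock}(a)$ it also merges in a second local trace, which is in $\mathsf{init}$ or ends with $\mathsf{unlock}(a)$, and whose sink becomes the $\to_a$-predecessor. $\mathsf{new}\,u_1\,t$ starts from the sink of $t$ a thread at $u_1$ with id $\nu(t)$, for a given map $\nu$ from local traces to $\mathcal I$; executing $x=\mathsf{create}(u_1)$ after $t$ sets $x$ to $\nu(t)$. $\mathcal T$ is the least set of local traces that contains $\mathsf{init}$ and is closed under $\mathsf{new}$ and all $[\![e]\!]$. The local constraint system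 $\mathcal C$ has unknowns $[u]$, $[a]$ with values in sets of local traces and the constraints $[u_0]\supseteq\mathsf{init}$, $[a]\supseteq\mathsf{init}$ and, for each $e=(u,A,u')\in\mathcal E$: $[u']\supseteq[\![e]\!](\eta[u],\eta[a])$ if $A=\mathsf{lock}(a)$, and $[u']\supseteq[\![e]\!](\eta[u])$ otherwise, with the side-effect $[a]\supseteq[\![e]\!](\eta[u])$ if $A=\mathsf{unlock}(a)$, and $[u_1]\supseteq\mathsf{new}\,u_1(\eta[u])$ if $A=(x=\mathsf{create}(u_1))$. Let $\eta$ be its least solution. **The analysis.** Let $\mathcal D$ be a complete lattice with a monotone $\gamma_{\mathcal D}:\mathcal D\to2^{\mathcal V}$ with $\gamma_{\mathcal D}(\top)=\mathcal V$. Let $\mathcal U$ be the lattice of upward-closed sets of subsets of $\mathsf M$ ordered by inclusion, each represented by its set of minimal elements, so that $\emptyset$ is least and $\{\emptyset\}$ greatest. The system $\mathcal C_3$ has unknowns $[u,S]$ ($u\in\mathcal N$, $S\subseteq\mathsf M$) with values $(W,P,\sigma)$, $W,P:\mathcal G\to\mathcal U$, $\sigma:\mathcal X\cup\mathcal G\to\mathcal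 D$, and $[g,a,S,w]$ ($g\in\mathcal G$, $a\in\mathsf M$, $S,w\subseteq\mathsf M$) with values in $\mathcal D$. Its constraints are $[u_0,\emptyset]\sqsupseteq(\lambda g.\emptyset,\ \lambda g.\{\emptyset\},\ \{x\mapsto\top\}\cup\{g\mapsto\bot\})$ and, for each edge $(u,A,v)$ and each $S\subseteq\mathsf M$, with $(W,P,\sigma)=\eta_3[u,S]$: * guard, $x=r$: $[v,S]\sqsupseteq(W,P,\sigma')$, where $\sigma'$ results from $\sigma$ by a sound abstract transfer function; * $x=\mathsf{create}(u_1)$: $[v,S]\sqsupseteq(W,P,\sigma\oplus\{x\mapsto i\})$ with side-effect $(\lambda g.\emptyset,\ \lambda g.\{\emptyset\},\ \sigma\oplus(\{\mathsf{self}\mapsto i\}\cup\{g\mapsto\bot\mid g\in\mathcal G\}))$ to $[u_1,\emptyset]$, where $i=\nu^\sharp\,u\,(W,P,\sigma)\,u_1$ and $\nu^\sharp$ soundly abstracts $\nu$; * $\mathsf{lock}(a)$: $[v,S\cup\{a\}]\sqsupseteq(W,P,\sigma)$; * $\mathsf{unlock}(a)$: $[v,S\setminus\{a\}]\sqsupseteq(W,\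 \lambda g.\,P\,g\sqcup\{S\setminus\{a\}\},\ \sigma)$ with side-effects $\sigma\,g$ to $[g,a,S\setminus\{a\},w]$ for all $g\in\mathcal G$ and all (minimal) $w\in W\,g$; * $g=x$: $[v,S]\sqsupseteq(W\oplus\{g\mapsto\{S\}\},\ P\oplus\{g\mapsto\{S\}\},\ \sigma\oplus\{g\mapsto\sigma\,x\})$; * $x=g$: $[v,S]\sqsupseteq(W,P,\sigma\oplus\{x\mapsto d\})$ with $d=\sigma\,g\sqcup\bigsqcup\{\eta_3[g,a,S',w]\mid a\in S,\ S\cap S'=\emptyset,\ \exists S''\in P\,g:S''\cap w=\emptyset,\ \exists S'''\in P\,g:a\notin S'''\}$. A post-solution of $\mathcal C_3$ is an assignment $\eta_3$ of the unknowns for which all contributions and side-effects of all constraints are below the values of $\eta_3$. **Abstraction.** A thread-local write to $g$ in $t$ is an edge $(\bar v,g=x,\bar v')$ of the ego thread of $t$. For a local trace $t$ let $\beta\,t=(W_t,P_t,\sigma_t)$: $\sigma_t\,x=\{t(x)\}$, where $t(x)$ is the value of the local $x$ at the sink. If there is a last thread-local write $(\bar v,g=x,\bar v')$ to $g$ in $t$,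 then $W_t\,g=\{L_t[\bar v']\}$, $P_t\,g$ is the upward closure of the set of locksets the ego thread has held since $\bar v'$, and $\sigma_t\,g$ consists of the value written; otherwise $W_t\,g=\emptyset$, $P_t\,g=\{\emptyset\}$ and $\sigma_t\,g=\emptyset$. Let $\mathcal T_S$ be the set of $t\in\mathcal T$ with lockset $S$ at the sink, and put $$\gamma_{u,S}(W,P,\sigma)=\{t\in\mathcal T_S\mid\mathsf{loc}(t)=u,\ W_t\sqsubseteq W,\ P_t\sqsubseteq P,\ \sigma_t\subseteq\gamma_{\mathcal D}\circ\sigma\}.$$ Let $\gamma_{g,a,S,w}(d)$ be the set of all $t\in\mathcal T_S$ that are in $\mathsf{init}$ or end with $\mathsf{unlock}(a)$ and in which either there is no thread-local write to $g$, or the last one, $(\bar v,g=x,\bar v')$, writes a value in $\gamma_{\mathcal D}(d)$ and $L_t[\bar v']\subseteq w$. **Theorem.** Every post-solution $\eta_3$ of $\mathcal C_3$ is sound w.r.t. the local trace semantics, i.e.: 1. for all $u\in\mathcal N$ and $S\subseteq\mathsf M$, every $t\in\eta[u]$ with lockset $S$ at its sink is in $\gamma_{u,S}(\eta_3[u,S])$;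 2. for all $g\in\mathcal G$, $a\in\mathsf M$ and $S,w\subseteq\mathsf M$, every $t\in\eta[a]$ with lockset $S$ at its sink, in which either there is no thread-local write to $g$ or the last one, $(\bar v,g=x,\bar v')$, satisfies $L_t[\bar v']\subseteq w$, is in $\gamma_{g,a,S,w}\big(\bigsqcup\{\eta_3[g,a,S,w']\mid w'\subseteq w\}\big)$. -/

import Mathlib

universe u v

/-! ### Side-effecting constraint systems -/

/-- A constraint `lhs ⊒ rhs`: the right-hand side takes an assignment of the unknowns and returns
the side-effects to all unknowns together with the contribution to the left-hand side. -/
structure Constraint (Unk : Type u) (D : Unk → Type v) where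
  lhs : Unk
  rhs : (∀ x, D x) → (∀ x, D x) × D lhs

/-- (Post-)solutions: all side-effects and all contributions are accounted for. -/
def IsSolution {Unk : Type u} {D : Unk → Type v} [∀ x, LE (D x)]
    (C : Set (Constraint Unk D)) (η : ∀ x, D x) : Prop :=
  ∀ c ∈ C, (∀ x, (c.rhs η).1 x ≤ η x) ∧ (c.rhs η).2 ≤ η c.lhs

/-! ### Programs -/

/-- Actions over locals `X`, globals `G`, mutexes `M`, program points `N`, expressions `R`. -/
inductive Act (X G M N R : Type u) : Type u
  | guard (r : R)
  | assign (x : X) (r : R)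
  | create (x : X) (u₁ : N)
  | lock (a : M)
  | unlock (a : M)
  | read (x : X) (g : G)
  | write (g : G) (x : X)

/-- The local variable assigned by an action (if any). -/
def Act.target {X G M N R : Type u} : Act X G M N R → Option X
  | .assign x _ => some x
  | .create x _ => some x
  | .read x _ => some x
  | _ => none

/-- The action reads or writes the global `g`. -/
def Act.Accesses {X G M N R : Type u} (A : Act X G M N R) (g : G) : Prop :=
  (∃ x, A = .read x g) ∨ (∃ x, A = .write g x)

/-- The lockset after the action, when `S` is the lockset before. -/
def Act.lockset {X G M N R : Type u} (A : Act X G M N R) (S : Set M) : Set M :=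
  match A with
  | .lock a => S ∪ {a}
  | .unlock a => S \ {a}
  | _ => S

/-- A concurrent program, given by its control-flow edges. `V` is the set of values; `ff` is the
value denoting `false`, all other values are truthy; `mtx g` is the mutex `m_g`. -/
structure Program (X G V M N R : Type u) where
  self : X
  tids : Set V
  tid₀ : V
  tid₀_mem : tid₀ ∈ tids
  ff : V
  eval : R → (X → V) → V
  u₀ : N
  edges : Set (N × Act X G M N R × N)
  mtx : G → M

/-- The standing assumptions on programs. -/
structure Program.WellFormed {X G V M N R : Type u} (P : Program X G V M N R) : Prop where
  /-- `self` is never assigned explicitly -/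
  self_not_assigned : ∀ u A u', (u, A, u') ∈ P.edges → A.target ≠ some P.self
  /-- at each program point there is at most one edge that creates a thread -/
  create_unique : ∀ u x y u₁ u₂ v w, (u, .create x u₁, v) ∈ P.edges →
    (u, .create y u₂, w) ∈ P.edges → x = y ∧ u₁ = u₂ ∧ v = w
  /-- each access to `g` occurs as `lock(m_g); access; unlock(m_g)` -/
  access_not_start : ∀ g u A u', (u, A, u') ∈ P.edges → A.Accesses g →
    u ≠ P.u₀ ∧ ∀ v x v', (v, .create x u, v') ∉ P.edges
  access_locked : ∀ g u A u', (u, A, u') ∈ P.edges → A.Accesses g →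
    ∀ v B, (v, B, u) ∈ P.edges → B = .lock (P.mtx g)
  access_unlocked : ∀ g u A u', (u, A, u') ∈ P.edges → A.Accesses g →
    ∀ B v, (u', B, v) ∈ P.edges → B = .unlock (P.mtx g)

/-- Effect of an action on the local state; here an arbitrary value may be read from a global, and
an arbitrary thread id may be returned by `create`. -/
def Program.Step {X G V M N R : Type u} [DecidableEq X] (P : Program X G V M N R) :
    Act X G M N R → (X → V) → (X → V) → Prop
  | .guard r, σ, σ' => P.eval r σ ≠ P.ff ∧ σ' = σ
  | .assign x r, σ, σ' => σ' = Function.update σ x (P.eval r σ)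
  | .create x _, σ, σ' => ∃ i ∈ P.tids, σ' = Function.update σ x i
  | .lock _, σ, σ' => σ' = σ
  | .unlock _, σ, σ' => σ' = σ
  | .read x _, σ, σ' => ∃ d, σ' = Function.update σ x d
  | .write _ _, σ, σ' => σ' = σ

/-! ### Traces -/

/-- A node `(j, u, σ)` of a trace. -/
structure Node (X V N : Type u) where
  idx : ℕ
  pt : N
  st : X → V

/-- The raw trace `ū₀ a₁ ū₁ … aₙ ūₙ` of a single thread, `n = len`; `act j` leads from state `j` to
state `j + 1`, and entries beyond `len` are irrelevant. -/
structure RawTrace (X G V M N R : Type u) where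
  len : ℕ
  pt : ℕ → N
  st : ℕ → X → V
  act : ℕ → Act X G M N R

namespace RawTrace
variable {X G V M N R : Type u}

def node (l : RawTrace X G V M N R) (j : ℕ) : Node X V N := ⟨j, l.pt j, l.st j⟩

def nodes (l : RawTrace X G V M N R) : Set (Node X V N) := {v | ∃ j ≤ l.len, v = l.node j}

def edges (l : RawTrace X G V M N R) : Set (Node X V N × Act X G M N R × Node X V N) :=
  {e | ∃ j < l.len, e = (l.node j, l.act j, l.node (j + 1))}

/-- `l` is a raw trace of the thread `i` of the program `P`. -/
def IsRaw [DecidableEq X] (P : Program X G V M N R) (i : V) (l : RawTrace X G V M N R) : Prop :=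
  (∀ j ≤ l.len, l.st j P.self = i) ∧
  ∀ j < l.len, (l.pt j, l.act j, l.pt (j + 1)) ∈ P.edges ∧ P.Step (l.act j) (l.st j) (l.st (j + 1))

end RawTrace

/-- The data `(τ, →_c, (→_a)_a)` of a trace, with a distinguished node `sink`. -/
@[ext]
structure TraceGraph (X G V M N R : Type u) where
  nodes : Set (Node X V N)
  edges : Set (Node X V N × Act X G M N R × Node X V N)
  cr : Node X V N → Node X V N → Prop
  lk : M → Node X V N → Node X V N → Prop
  sink : Node X V N

namespace TraceGraph
variable {X G V M N R : Type u}

/-- The immediate causality relation: program order, create order and locking orders. -/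
def Succ (t : TraceGraph X G V M N R) (v v' : Node X V N) : Prop :=
  (∃ A, (v, A, v') ∈ t.edges) ∨ t.cr v v' ∨ ∃ a, t.lk a v v'

/-- The causality order. -/
def Le (t : TraceGraph X G V M N R) : Node X V N → Node X V N → Prop :=
  Relation.ReflTransGen t.Succ

/-- `a⁺`: nodes with an incoming edge `lock(a)`. -/
def acq (t : TraceGraph X G V M N R) (a : M) : Set (Node X V N) :=
  {v | ∃ z, (z, Act.lock a, v) ∈ t.edges}

/-- `a⁻`: nodes with an incoming edge `unlock(a)`. -/
def rel (t : TraceGraph X G V M N R) (a : M) : Set (Node X V N) :=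
  {v | ∃ z, (z, Act.unlock a, v) ∈ t.edges}

/-- Nodes that are minimal w.r.t. the program order. -/
def starts (t : TraceGraph X G V M N R) : Set (Node X V N) :=
  {v | v ∈ t.nodes ∧ ∀ z A, (z, A, v) ∉ t.edges}

/-- The mutex `a` has been acquired, and not yet been released, by the thread of the node. -/
inductive Holds (t : TraceGraph X G V M N R) (a : M) : Node X V N → Prop
  | acquire {z v} : (z, Act.lock a, v) ∈ t.edges → Holds t a v
  | keep {z A v} : (z, A, v) ∈ t.edges → A ≠ Act.unlock a → Holds t a z → Holds t a v

/-- The lockset `L_t[v]`. -/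
def lockset (t : TraceGraph X G V M N R) (v : Node X V N) : Set M := {a | t.Holds a v}

variable [DecidableEq X]

/-- The graph is a union of raw traces, one for each thread id in some set of thread ids. -/
def IsRawGlobal (P : Program X G V M N R) (t : TraceGraph X G V M N R) : Prop :=
  ∃ (I : Set V) (l : V → RawTrace X G V M N R), I ⊆ P.tids ∧ (∀ i ∈ I, (l i).IsRaw P i) ∧
    t.nodes = {v | ∃ i ∈ I, v ∈ (l i).nodes} ∧ t.edges = {e | ∃ i ∈ I, e ∈ (l i).edges}

/-- `t` is a global trace of `P` with least node `o`. -/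
structure IsGlobalTrace (P : Program X G V M N R) (t : TraceGraph X G V M N R) (o : Node X V N) :
    Prop where
  raw : t.IsRawGlobal P
  le_antisymm : ∀ v v', t.Le v v' → t.Le v' v → v = v'
  root_mem : o ∈ t.nodes
  root_idx : o.idx = 0
  root_pt : o.pt = P.u₀
  root_self : o.st P.self = P.tid₀
  root_le : ∀ v ∈ t.nodes, t.Le o v
  /-- Create order: a thread start other than the root is created from a node at whose program
  point there is a corresponding `create` edge. -/
  cr_dom : ∀ z s, t.cr z s → z ∈ t.nodes ∧ s ∈ t.starts ∧ s ≠ o ∧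
    ∃ x u', (z.pt, Act.create x s.pt, u') ∈ P.edges
  cr_pred : ∀ s ∈ t.starts, s ≠ o → ∃! z, t.cr z s
  cr_succ : ∀ z s s', t.cr z s → t.cr z s' → s = s'
  cr_state : ∀ z s, t.cr z s →
    s.idx = 0 ∧ ∃ i ∈ P.tids, s.st = Function.update z.st P.self i
  /-- If the creating thread proceeds beyond the creating node within `t`, then by the `create`
  action, and both threads agree on the id of the created thread. -/
  cr_agree : ∀ z s A z', t.cr z s → (z, A, z') ∈ t.edges →
    ∃ x, A = .create x s.pt ∧ z'.st x = s.st P.self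
  /-- Locking orders. -/
  lk_dom : ∀ a z y, t.lk a z y → (z ∈ t.rel a ∨ z = o) ∧ y ∈ t.acq a
  lk_pred : ∀ a, ∀ y ∈ t.acq a, ∃! z, t.lk a z y
  lk_succ : ∀ a z y y', t.lk a z y → t.lk a z y' → y = y'
  /-- Mutexes are not re-entrant and only released by a thread holding them. -/
  lock_free : ∀ a z y, (z, Act.lock a, y) ∈ t.edges → a ∉ t.lockset z
  unlock_held : ∀ a z y, (z, Act.unlock a, y) ∈ t.edges → a ∈ t.lockset z
  /-- Globals: the value read is the value of a maximal preceding write. -/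
  globals : ∀ v x g v', (v, Act.read x g, v') ∈ t.edges →
    ∃ z y z', (z, Act.write g y, z') ∈ t.edges ∧ t.Le z' v ∧
      (∀ z₂ y₂ z₂', (z₂, Act.write g y₂, z₂') ∈ t.edges → t.Le z₂' v → t.Le z' z₂' → z₂' = z') ∧
      v'.st x = z.st y

/-- A local trace is a global trace whose causality order has the greatest element `sink`. -/
def IsLocalTrace (P : Program X G V M N R) (t : TraceGraph X G V M N R) : Prop :=
  (∃ o, t.IsGlobalTrace P o) ∧ t.sink ∈ t.nodes ∧ ∀ v ∈ t.nodes, t.Le v t.sink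

/-- The one-node graph `0_σ`. -/
def start (P : Program X G V M N R) (σ : X → V) : TraceGraph X G V M N R where
  nodes := {⟨0, P.u₀, σ⟩}
  edges := ∅
  cr := fun _ _ => False
  lk := fun _ _ _ => False
  sink := ⟨0, P.u₀, σ⟩

/-- Prolong the ego thread by the action `A`, reaching point `u'` with local state `σ'`. -/
def extend (t : TraceGraph X G V M N R) (A : Act X G M N R) (u' : N) (σ' : X → V) :
    TraceGraph X G V M N R where
  nodes := insert ⟨t.sink.idx + 1, u', σ'⟩ t.nodes
  edges := insert (t.sink, A, ⟨t.sink.idx + 1, u', σ'⟩) t.edges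
  cr := t.cr
  lk := t.lk
  sink := ⟨t.sink.idx + 1, u', σ'⟩

/-- Merge `t₀` and `t₁` and prolong the ego thread of `t₀` by `lock(a)`, where `a` is taken over from
the sink of `t₁`. -/
def extendLock (t₀ t₁ : TraceGraph X G V M N R) (a : M) (u' : N) : TraceGraph X G V M N R where
  nodes := insert ⟨t₀.sink.idx + 1, u', t₀.sink.st⟩ (t₀.nodes ∪ t₁.nodes)
  edges := insert (t₀.sink, .lock a, ⟨t₀.sink.idx + 1, u', t₀.sink.st⟩) (t₀.edges ∪ t₁.edges)
  cr := fun z s => t₀.cr z s ∨ t₁.cr z s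
  lk := fun b z y => t₀.lk b z y ∨ t₁.lk b z y ∨
    (b = a ∧ z = t₁.sink ∧ y = ⟨t₀.sink.idx + 1, u', t₀.sink.st⟩)
  sink := ⟨t₀.sink.idx + 1, u', t₀.sink.st⟩

/-- Start a new thread with id `i` at point `u₁` from the sink of `t`. -/
def extendNew (P : Program X G V M N R) (t : TraceGraph X G V M N R) (u₁ : N) (i : V) :
    TraceGraph X G V M N R where
  nodes := insert ⟨0, u₁, Function.update t.sink.st P.self i⟩ t.nodes
  edges := t.edges
  cr := fun z s => t.cr z s ∨ (z = t.sink ∧ s = ⟨0, u₁, Function.update t.sink.st P.self i⟩)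
  lk := t.lk
  sink := ⟨0, u₁, Function.update t.sink.st P.self i⟩

end TraceGraph

/-- The type of local traces of `P`. -/
def LocalTrace {X G V M N R : Type u} [DecidableEq X] (P : Program X G V M N R) : Type u :=
  {t : TraceGraph X G V M N R // t.IsLocalTrace P}

namespace LocalTrace
variable {X G V M N R : Type u} [DecidableEq X] {P : Program X G V M N R}

/-- The program point of the sink. -/
def loc (t : LocalTrace P) : N := t.1.sink.pt

/-- The thread id of the ego thread. -/
def id (t : LocalTrace P) : V := t.1.sink.st P.self

/-- The last action of the ego thread is `A`. -/
def LastIs (t : LocalTrace P) (A : Act X G M N R) : Prop := ∃ z, (z, A, t.1.sink) ∈ t.1.edges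

/-- The lockset at the sink. -/
def locks (t : LocalTrace P) : Set M := t.1.lockset t.1.sink

/-- The initial local traces. -/
def init (P : Program X G V M N R) : Set (LocalTrace P) :=
  {t | ∃ σ : X → V, σ P.self = P.tid₀ ∧ t.1 = TraceGraph.start P σ}

/-- `new u₁ t`, where `ν` provides the id of the created thread. -/
def new (ν : LocalTrace P → P.tids) (u₁ : N) (t : LocalTrace P) : Set (LocalTrace P) :=
  {t₁ | (∃ x u', (t.loc, Act.create x u₁, u') ∈ P.edges) ∧ t₁.1 = t.1.extendNew P u₁ (ν t)}

/-- The semantics of an edge `(u, A, u')` where `A` is not a lock operation. -/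
def sem (ν : LocalTrace P → P.tids) (u : N) (A : Act X G M N R) (u' : N) (t₀ : LocalTrace P) :
    Set (LocalTrace P) :=
  {t | t₀.loc = u ∧ ∃ σ', t.1 = t₀.1.extend A u' σ' ∧ ∀ x u₁, A = .create x u₁ → σ' x = ν t₀}

/-- The semantics of an edge `(u, lock(a), u')`. -/
def semLock (u : N) (a : M) (u' : N) (t₀ t₁ : LocalTrace P) : Set (LocalTrace P) :=
  {t | t₀.loc = u ∧ (t₁ ∈ init P ∨ t₁.LastIs (.unlock a)) ∧ t.1 = t₀.1.extendLock t₁.1 a u'}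

/-- The least set `𝒯` of local traces that contains `init` and is closed under `new` and the
semantics of all control-flow edges. -/
inductive Reachable (ν : LocalTrace P → P.tids) : LocalTrace P → Prop
  | init {t} : t ∈ init P → Reachable ν t
  | new {u₁ t t₁} : Reachable ν t → t₁ ∈ new ν u₁ t → Reachable ν t₁
  | step {u A u' t₀ t} : (u, A, u') ∈ P.edges → (∀ a, A ≠ .lock a) → Reachable ν t₀ →
      t ∈ sem ν u A u' t₀ → Reachable ν t
  | lock {u a u' t₀ t₁ t} : (u, .lock a, u') ∈ P.edges → Reachable ν t₀ → Reachable ν t₁ →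
      t ∈ semLock u a u' t₀ t₁ → Reachable ν t

/-- `𝒯_S`: the local traces in `𝒯` with lockset `S` at the sink. -/
def withLocks (ν : LocalTrace P → P.tids) (S : Set M) : Set (LocalTrace P) :=
  {t | Reachable ν t ∧ t.locks = S}

/-- `last_tl_write_g t = (v, g = x, v')`. -/
def LastTlWrite (t : LocalTrace P) (g : G) (v : Node X V N) (x : X) (v' : Node X V N) : Prop :=
  (v, Act.write g x, v') ∈ t.1.edges ∧ v.st P.self = t.id ∧
    ∀ z y z', (z, Act.write g y, z') ∈ t.1.edges → z.st P.self = t.id → z'.idx ≤ v'.idx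

/-- `last_tl_write_g t = ⊥`. -/
def NoTlWrite (t : LocalTrace P) (g : G) : Prop :=
  ∀ z y z', (z, Act.write g y, z') ∈ t.1.edges → z.st P.self ≠ t.id

end LocalTrace

/-! ### The concrete local constraint system -/

inductive ConcUnk (M N : Type u) : Type u
  | pt (u : N)
  | mx (a : M)

section Concrete
variable {X G V M N R : Type u} [DecidableEq X] {P : Program X G V M N R}
open LocalTrace

/-- Right-hand side for the edge `(u, A, u')`. -/
def concRhs (ν : LocalTrace P → P.tids) (u : N) (A : Act X G M N R) (u' : N)
    (η : ConcUnk M N → Set (LocalTrace P)) :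
    (ConcUnk M N → Set (LocalTrace P)) × Set (LocalTrace P) :=
  match A with
  | .create x u₁ =>
    (fun
      | .pt v => {t | v = u₁ ∧ ∃ t₀ ∈ η (.pt u), t ∈ new ν u₁ t₀}
      | .mx _ => ∅,
     {t | ∃ t₀ ∈ η (.pt u), t ∈ sem ν u (.create x u₁) u' t₀})
  | .lock a =>
    (fun _ => ∅, {t | ∃ t₀ ∈ η (.pt u), ∃ t₁ ∈ η (.mx a), t ∈ semLock u a u' t₀ t₁})
  | .unlock a =>
    (fun
      | .pt _ => ∅
      | .mx b => {t | b = a ∧ ∃ t₀ ∈ η (.pt u), t ∈ sem ν u (.unlock a) u' t₀},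
     {t | ∃ t₀ ∈ η (.pt u), t ∈ sem ν u (.unlock a) u' t₀})
  | A => (fun _ => ∅, {t | ∃ t₀ ∈ η (.pt u), t ∈ sem ν u A u' t₀})

/-- The local constraint system `𝒞` of the trace semantics. -/
def concSystem (ν : LocalTrace P → P.tids) :
    Set (Constraint (ConcUnk M N) (fun _ => Set (LocalTrace P))) :=
  {⟨.pt P.u₀, fun _ => (fun _ => ∅, init P)⟩} ∪
  {c | ∃ a : M, c = ⟨.mx a, fun _ => (fun _ => ∅, init P)⟩} ∪
  {c | ∃ u A u', (u, A, u') ∈ P.edges ∧ c = ⟨.pt u', concRhs ν u A u'⟩}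

end Concrete

/-! ### Write-Centered Reading -/

/-- `𝒰_M`: upward-closed sets of locksets, ordered by inclusion (Mathlib orders `UpperSet` by
reverse inclusion, whence the order dual). -/
abbrev UpLocks (M : Type u) : Type u := (UpperSet (Set M))ᵒᵈ

namespace UpLocks
variable {M : Type u}

/-- The element represented by `{S}`. -/
def single (S : Set M) : UpLocks M := OrderDual.toDual (UpperSet.Ici S)

/-- The locksets in an upward-closed set. -/
def sets (U : UpLocks M) : Set (Set M) := (OrderDual.ofDual U : UpperSet (Set M))

/-- The minimal elements, which represent an upward-closed set. -/
def mins (U : UpLocks M) : Set (Set M) := {S | Minimal (· ∈ U.sets) S}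

/-- The upward closure of a set of locksets. -/
def closure (B : Set (Set M)) : UpLocks M := OrderDual.toDual (upperClosure B)

end UpLocks

/-- Abstract local states `(W, P, σ)`. -/
abbrev AbsState (X G M D : Type u) : Type u := (G → UpLocks M) × (G → UpLocks M) × (X ⊕ G → D)

/-- Unknowns `[u, S]` and `[g, a, S, w]`. -/
inductive AbsUnk (G M N : Type u) : Type u
  | pt (u : N) (S : Set M)
  | glob (g : G) (a : M) (S w : Set M)

/-- The lattice of values of an unknown. -/
def AbsVal (X G M N D : Type u) : AbsUnk G M N → Type u
  | .pt _ _ => AbsState X G M D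
  | .glob _ _ _ _ => D

instance AbsVal.instCompleteLattice {X G M N D : Type u} [CompleteLattice D] :
    (x : AbsUnk G M N) → CompleteLattice (AbsVal X G M N D x)
  | .pt _ _ => inferInstanceAs (CompleteLattice (AbsState X G M D))
  | .glob _ _ _ _ => inferInstanceAs (CompleteLattice D)

/-- The parameters of the analysis: the concretization `γ_D` of abstract values, the abstract thread
id `ν♯`, and the transfer functions for guards and for computations on locals. -/
structure AbsDomain (X G V M N R D : Type u) where
  γ : D → Set V
  νs : N → AbsState X G M D → N → D
  guardT : R → (X ⊕ G → D) → (X ⊕ G → D)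
  assignT : X → R → (X ⊕ G → D) → (X ⊕ G → D)

section Analysis
variable {X G V M N R D : Type u} [DecidableEq X] [DecidableEq G] [CompleteLattice D]

/-- The right-hand side for the edge `(u, A, u')` and the lockset `S`. -/
def absRhs (P : Program X G V M N R) (Dm : AbsDomain X G V M N R D) (u : N) (S : Set M)
    (A : Act X G M N R) (η : ∀ x, AbsVal X G M N D x) :
    (∀ x, AbsVal X G M N D x) × AbsState X G M D :=
  let s : AbsState X G M D := η (.pt u S)
  let W := s.1
  let Q := s.2.1
  let σ := s.2.2
  match A with
  | .guard r => (⊥, (W, Q, Dm.guardT r σ))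
  | .assign x r => (⊥, (W, Q, Dm.assignT x r σ))
  | .create x u₁ =>
    let i := Dm.νs u (W, Q, σ) u₁
    let σ' : X ⊕ G → D :=
      Sum.elim (Function.update (fun y => σ (.inl y)) P.self i) (fun _ => ⊥)
    let s' : AbsState X G M D := (fun _ => ⊥, fun _ => UpLocks.single ∅, σ')
    (fun
      | .pt v T => (⨆ _ : v = u₁ ∧ T = ∅, s' : AbsState X G M D)
      | .glob _ _ _ _ => (⊥ : D),
     (W, Q, Function.update σ (.inl x) i))
  | .lock _ => (⊥, (W, Q, σ))
  | .unlock a =>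
    (fun
      | .pt _ _ => (⊥ : AbsState X G M D)
      | .glob g b T w => (⨆ _ : b = a ∧ T = S \ {a} ∧ w ∈ (W g).mins, σ (.inr g) : D),
     (W, fun g => Q g ⊔ UpLocks.single (S \ {a}), σ))
  | .write g x =>
    (⊥, (Function.update W g (UpLocks.single S), Function.update Q g (UpLocks.single S),
      Function.update σ (.inr g) (σ (.inl x))))
  | .read x g =>
    let d : D := σ (.inr g) ⊔
      sSup {d | ∃ a S' w, a ∈ S ∧ S ∩ S' = ∅ ∧ (∃ S'' ∈ (Q g).mins, S'' ∩ w = ∅) ∧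
        (∃ S''' ∈ (Q g).mins, a ∉ S''') ∧ d = η (.glob g a S' w)}
    (⊥, (W, Q, Function.update σ (.inl x) d))

/-- The constraint system `𝒞₃` of Write-Centered Reading. -/
def absSystem (P : Program X G V M N R) (Dm : AbsDomain X G V M N R D) :
    Set (Constraint (AbsUnk G M N) (AbsVal X G M N D)) :=
  {⟨.pt P.u₀ ∅, fun _ => (⊥, ((fun _ => ⊥, fun _ => UpLocks.single ∅,
      Sum.elim (fun _ => ⊤) (fun _ => ⊥)) : AbsState X G M D))⟩} ∪
  {c | ∃ u A u' S, (u, A, u') ∈ P.edges ∧ c = ⟨.pt u' (A.lockset S), absRhs P Dm u S A⟩}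

end Analysis

/-! ### Soundness -/

section Soundness
variable {X G V M N R D : Type u} [DecidableEq X] {P : Program X G V M N R}
open LocalTrace

/-- The locksets held by the ego thread since the node `v'` of the ego thread. -/
def LocalTrace.minLocksetSince (t : LocalTrace P) (v' : Node X V N) : UpLocks M :=
  UpLocks.closure {L | ∃ y ∈ t.1.nodes, y.st P.self = t.id ∧ v'.idx ≤ y.idx ∧ L = t.1.lockset y}

/-- The `W`-component of the abstraction `β t` (empty if there is no thread-local write to `g`). -/
def LocalTrace.betaW (t : LocalTrace P) (g : G) : UpLocks M :=
  UpLocks.closure {L | ∃ v x v', t.LastTlWrite g v x v' ∧ L = t.1.lockset v'}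

/-- The `P`-component of the abstraction `β t`. -/
def LocalTrace.betaP (t : LocalTrace P) (g : G) : UpLocks M :=
  UpLocks.closure {L | (t.NoTlWrite g ∧ L = ∅) ∨
    ∃ v x v', t.LastTlWrite g v x v' ∧ L ∈ (t.minLocksetSince v').sets}

/-- The `σ`-component of the abstraction `β t`: the values of the locals at the sink and the values
of the last thread-local writes to globals. -/
def LocalTrace.betaVal (t : LocalTrace P) : X ⊕ G → Set V
  | .inl x => {t.1.sink.st x}
  | .inr g => {d | ∃ v x v', t.LastTlWrite g v x v' ∧ d = v.st x}

/-- The concretization `γ_{u,S}`. -/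
def gammaPt (ν : LocalTrace P → P.tids) (γ : D → Set V) (u : N) (S : Set M)
    (s : AbsState X G M D) : Set (LocalTrace P) :=
  {t | t ∈ withLocks ν S ∧ t.loc = u ∧ (∀ g, t.betaW g ≤ s.1 g) ∧ (∀ g, t.betaP g ≤ s.2.1 g) ∧
    ∀ y, t.betaVal y ⊆ γ (s.2.2 y)}

/-- The concretization `γ_{g,a,S,w}`. -/
def gammaGlob (ν : LocalTrace P → P.tids) (γ : D → Set V) (g : G) (a : M) (S w : Set M) (d : D) :
    Set (LocalTrace P) :=
  {t | t ∈ withLocks ν S ∧ (t ∈ init P ∨ t.LastIs (.unlock a)) ∧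
    ((∃ v x v', t.LastTlWrite g v x v' ∧ v.st x ∈ γ d ∧ t.1.lockset v' ⊆ w) ∨ t.NoTlWrite g)}

/-- `split[η] [u, S]`. -/
def splitPt (η : ConcUnk M N → Set (LocalTrace P)) (u : N) (S : Set M) : Set (LocalTrace P) :=
  η (.pt u) ∩ {t | t.locks = S}

/-- `split[η] [g, a, S, w]`. -/
def splitGlob (η : ConcUnk M N → Set (LocalTrace P)) (g : G) (a : M) (S w : Set M) :
    Set (LocalTrace P) :=
  η (.mx a) ∩ {t | t.locks = S ∧
    ((∃ v x v', t.LastTlWrite g v x v' ∧ t.1.lockset v' ⊆ w) ∨ t.NoTlWrite g)}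

/-- The assumptions on the parameters of the analysis: `γ_D` is monotone with `γ_D ⊤` everything,
`ν♯` describes the ids of created threads, and the transfer functions for guards and for assignments
to locals describe the effect on the locals and keep (a superset of) the values of the globals. -/
structure AbsDomain.Admissible [CompleteLattice D] (Dm : AbsDomain X G V M N R D)
    (ν : LocalTrace P → P.tids) : Prop where
  γ_mono : Monotone Dm.γ
  γ_top : Dm.γ ⊤ = Set.univ
  νs_spec : ∀ u S s x u₁ u' t, (u, Act.create x u₁, u') ∈ P.edges →
    t ∈ gammaPt ν Dm.γ u S s → (ν t : V) ∈ Dm.γ (Dm.νs u s u₁)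
  guardT_spec : ∀ r (σ : X → V) (ρ : G → Set V) (σs : X ⊕ G → D), P.eval r σ ≠ P.ff →
    (∀ x, σ x ∈ Dm.γ (σs (.inl x))) → (∀ g, ρ g ⊆ Dm.γ (σs (.inr g))) →
    (∀ x, σ x ∈ Dm.γ (Dm.guardT r σs (.inl x))) ∧ ∀ g, ρ g ⊆ Dm.γ (Dm.guardT r σs (.inr g))
  assignT_spec : ∀ y r (σ : X → V) (ρ : G → Set V) (σs : X ⊕ G → D),
    (∀ x, σ x ∈ Dm.γ (σs (.inl x))) → (∀ g, ρ g ⊆ Dm.γ (σs (.inr g))) →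
    (∀ x, Function.update σ y (P.eval r σ) x ∈ Dm.γ (Dm.assignT y r σs (.inl x))) ∧
      ∀ g, ρ g ⊆ Dm.γ (Dm.assignT y r σs (.inr g))

end Soundness

/-! ### Structure of traces -/

namespace TraceGraph
variable {X G V M N R : Type u} {P : Program X G V M N R} {t t' : TraceGraph X G V M N R}

/-! The traces satisfying a suitable invariant form a post-solution of the concrete system, so its
least solution lies below them. The invariant (`IsSoundTrace`) asks that a trace be finite, that it
be described by `η₃`, and that every node be the sink of a subtrace that is also described. The last
clause serves reads: a foreign value becomes visible through an `unlock` somewhere inside the trace,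
and what that `unlock` contributes is known from the subtrace ending there.

For every action except a read of a foreign value, the abstraction of the prolonged trace changes
just as the abstract constraint prescribes (`pt_of_prolongs`, `glob_of_prolongs`). This needs that
new nodes of the ego thread arise only at its end, even when a lock merges in a second trace.

For a read of `g`, consider the maximal preceding write. If it is by the ego thread, the local value
`σ g` covers it. Otherwise let `r` be the last release, by the writing thread after its write, of a
mutex `a` that the reader now holds; one exists since both accesses are protected by `m_g`. Any
mutex held at both `r` and the read would have to be released even later, so the two locksets are
disjoint. If the ego thread wrote `g` before, that write precedes the foreign one; since then the
ego thread has passed a node whose lockset is disjoint from that of the foreign write, and a node at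
which it did not hold `a`. These are the side conditions under which the read constraint includes
`[g,a,S',w]` (`exists_unlock_of_foreign_write`, `read_mem`).

All of this rests on `mutual_exclusion`: following the locking order backwards, every acquisition of
`a` is reached from the root, and the resulting chains are deterministic, hence linear. -/

theorem le_of_lk {a z y} (e : t.lk a z y) : t.Le z y :=
  Relation.ReflTransGen.single (Or.inr (Or.inr ⟨a, e⟩))

variable [DecidableEq X]

namespace IsRawGlobal

theorem edge_mem (h : t.IsRawGlobal P) {z v A} (e : (z, A, v) ∈ t.edges) :
    z ∈ t.nodes ∧ v ∈ t.nodes ∧ v.idx = z.idx + 1 ∧ v.st P.self = z.st P.self ∧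
      (z.pt, A, v.pt) ∈ P.edges ∧ P.Step A z.st v.st := by
  obtain ⟨I, l, -, hl, hn, he⟩ := h
  rw [he] at e
  obtain ⟨i, hi, j, hj, e⟩ := e
  simp only [Prod.mk.injEq] at e
  obtain ⟨rfl, rfl, rfl⟩ := e
  have h1 := hl i hi
  refine ⟨?_, ?_, rfl, ?_, h1.2 j hj⟩
  · rw [hn]; exact ⟨i, hi, j, hj.le, rfl⟩
  · rw [hn]; exact ⟨i, hi, j + 1, hj, rfl⟩
  · exact (h1.1 _ hj).trans (h1.1 _ hj.le).symm

/-- As `self` is constant along a raw trace, thread id and index serve as coordinates on the nodes.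
-/
theorem node_ext (h : t.IsRawGlobal P) {v v'} (hv : v ∈ t.nodes) (hv' : v' ∈ t.nodes)
    (hs : v.st P.self = v'.st P.self) (hi : v.idx = v'.idx) : v = v' := by
  obtain ⟨I, l, -, hl, hn, -⟩ := h
  rw [hn] at hv hv'
  obtain ⟨i, hi1, j, hj, rfl⟩ := hv
  obtain ⟨i', hi1', j', hj', rfl⟩ := hv'
  obtain rfl : j = j' := hi
  have h1 : i = i' := ((hl i hi1).1 _ hj).symm.trans (hs.trans ((hl i' hi1').1 _ hj'))
  rw [h1]

theorem exists_pred (h : t.IsRawGlobal P) {v} (hv : v ∈ t.nodes) (h0 : 0 < v.idx) :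
    ∃ z A, (z, A, v) ∈ t.edges := by
  obtain ⟨I, l, -, hl, hn, he⟩ := h
  rw [hn] at hv
  obtain ⟨i, hi, j, hj, rfl⟩ := hv
  obtain ⟨k, rfl⟩ : ∃ k, j = k + 1 := ⟨j - 1, by change 0 < j at h0; omega⟩
  exact ⟨(l i).node k, (l i).act k, by rw [he]; exact ⟨i, hi, k, hj, rfl⟩⟩

theorem pred_unique (h : t.IsRawGlobal P) {z z' v A A'} (e : (z, A, v) ∈ t.edges)
    (e' : (z', A', v) ∈ t.edges) : z = z' ∧ A = A' := by
  obtain ⟨I, l, -, hl, hn, he⟩ := h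
  rw [he] at e e'
  obtain ⟨i, hi, j, hj, e⟩ := e
  obtain ⟨i', hi', j', hj', e'⟩ := e'
  simp only [Prod.mk.injEq] at e e'
  obtain ⟨rfl, rfl, rfl⟩ := e
  obtain ⟨rfl, rfl, h3⟩ := e'
  have h4 : j + 1 = j' + 1 := congrArg Node.idx h3
  obtain rfl : j = j' := by omega
  have h5 : i = i' := ((hl i hi).1 _ hj).symm.trans
    ((congrArg (fun n => n.st P.self) h3).trans ((hl i' hi').1 _ hj'))
  rw [h5]; exact ⟨rfl, rfl⟩

theorem exists_node (h : t.IsRawGlobal P) {v} (hv : v ∈ t.nodes) {k : ℕ} (hk : k ≤ v.idx) :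
    ∃ z ∈ t.nodes, z.st P.self = v.st P.self ∧ z.idx = k := by
  obtain ⟨I, l, -, hl, hn, he⟩ := h
  rw [hn] at hv ⊢
  obtain ⟨i, hi, j, hj, rfl⟩ := hv
  have hk' : k ≤ (l i).len := le_trans hk hj
  exact ⟨(l i).node k, ⟨i, hi, k, hk', rfl⟩, ((hl i hi).1 _ hk').trans ((hl i hi).1 _ hj).symm, rfl⟩

/-- Within a thread, program order is the order of indices. -/
theorem le_of_idx_le (h : t.IsRawGlobal P) {v v'} (hv : v ∈ t.nodes) (hv' : v' ∈ t.nodes)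
    (hs : v.st P.self = v'.st P.self) (hi : v.idx ≤ v'.idx) : t.Le v v' := by
  obtain ⟨d, hd⟩ := Nat.exists_eq_add_of_le hi
  induction d generalizing v' with
  | zero => rw [h.node_ext hv hv' hs (by omega)]; exact Relation.ReflTransGen.refl
  | succ d ih =>
    obtain ⟨z, A, e⟩ := h.exists_pred hv' (by omega)
    obtain ⟨hz, -, hi', hs', -⟩ := h.edge_mem e
    exact (ih hz (hs.trans hs') (by omega) (by omega)).tail (Or.inl ⟨A, e⟩)

end IsRawGlobal

/-! ### Causality within a thread and held mutexes -/

namespace IsGlobalTrace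
variable {o : Node X V N}

/-- Indices order a thread causally, so a non-increasing index would close a causal cycle. -/
theorem idx_lt_of_le (h : t.IsGlobalTrace P o) {v v'} (hv : v ∈ t.nodes) (hv' : v' ∈ t.nodes)
    (hs : v.st P.self = v'.st P.self) (hle : t.Le v v') (hne : v ≠ v') : v.idx < v'.idx := by
  by_contra hc
  exact hne (h.le_antisymm _ _ hle (h.raw.le_of_idx_le hv' hv hs.symm (by omega)))

/-- A node at which a global is accessed is entered by locking the mutex of the global. -/
theorem exists_lock_of_access (hP : P.WellFormed) (h : t.IsGlobalTrace P o) {v A u' g}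
    (hv : v ∈ t.nodes) (hA : (v.pt, A, u') ∈ P.edges) (hg : A.Accesses g) :
    ∃ z, (z, Act.lock (P.mtx g), v) ∈ t.edges := by
  by_cases hs : ∃ z B, (z, B, v) ∈ t.edges
  · obtain ⟨z, B, e⟩ := hs
    obtain rfl := hP.access_locked g _ _ _ hA hg _ _ (h.raw.edge_mem e).2.2.2.2.1
    exact ⟨z, e⟩
  · push Not at hs
    exfalso
    obtain ⟨h1, h2⟩ := hP.access_not_start g _ _ _ hA hg
    by_cases ho : v = o
    · exact h1 (ho ▸ h.root_pt)
    · obtain ⟨z, hz, -⟩ := h.cr_pred v ⟨hv, hs⟩ ho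
      obtain ⟨-, -, -, x, u', hc⟩ := h.cr_dom _ _ hz
      exact h2 _ _ _ hc

theorem holds_of_access (hP : P.WellFormed) (h : t.IsGlobalTrace P o) {v A u' g}
    (hv : v ∈ t.nodes) (hA : (v.pt, A, u') ∈ P.edges) (hg : A.Accesses g) :
    t.Holds (P.mtx g) v :=
  (h.exists_lock_of_access hP hv hA hg).elim fun _ e => .acquire e

theorem holds_of_write (hP : P.WellFormed) (h : t.IsGlobalTrace P o) {z g x v}
    (e : (z, Act.write g x, v) ∈ t.edges) : t.Holds (P.mtx g) v := by
  have h1 := h.raw.edge_mem e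
  exact .keep e (by simp) (h.holds_of_access hP h1.1 h1.2.2.2.2.1 (Or.inr ⟨x, rfl⟩))

theorem not_holds_of_unlock (h : t.IsGlobalTrace P o) {z v a}
    (e : (z, Act.unlock a, v) ∈ t.edges) : ¬ t.Holds a v := by
  intro hh
  cases hh with
  | acquire e' => exact absurd (h.raw.pred_unique e e').2 (by simp)
  | keep e' hA _ => exact hA (h.raw.pred_unique e e').2.symm

/-- The acquisition from which on a mutex is held. -/
theorem exists_acquisition (h : t.IsGlobalTrace P o) {a n} (hn : t.Holds a n) :
    n ∈ t.nodes ∧ ∃ q₀ q, (q₀, Act.lock a, q) ∈ t.edges ∧ q.st P.self = n.st P.self ∧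
      q.idx ≤ n.idx ∧ ∀ m ∈ t.nodes, m.st P.self = n.st P.self → q.idx ≤ m.idx → m.idx ≤ n.idx →
        t.Holds a m := by
  induction hn with
  | @acquire z v e =>
    have h1 := h.raw.edge_mem e
    refine ⟨h1.2.1, z, v, e, rfl, le_rfl, fun m hm hs h2 h3 => ?_⟩
    rw [h.raw.node_ext hm h1.2.1 hs (by omega)]
    exact .acquire e
  | @keep z A v e hA hz ih =>
    have h1 := h.raw.edge_mem e
    obtain ⟨-, q₀, q, hq, hs, hi, hall⟩ := ih
    refine ⟨h1.2.1, q₀, q, hq, hs.trans h1.2.2.2.1.symm, by omega, fun m hm hms h2 h3 => ?_⟩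
    by_cases hmv : m.idx = v.idx
    · rw [h.raw.node_ext hm h1.2.1 hms hmv]
      exact .keep e hA hz
    · exact hall m hm (hms.trans h1.2.2.2.1) h2 (by omega)

/-! ### Mutual exclusion -/

/-- `r` is the release that follows the acquisition `q` of `a`. -/
def Releases (P : Program X G V M N R) (t : TraceGraph X G V M N R) (a : M) (q r : Node X V N) :
    Prop :=
  r ∈ t.rel a ∧ r.st P.self = q.st P.self ∧ q.idx < r.idx ∧
    ∀ m ∈ t.nodes, m.st P.self = q.st P.self → q.idx ≤ m.idx → m.idx < r.idx → t.Holds a m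

/-- `q'` is the acquisition of `a` that immediately follows the acquisition `q`. -/
def NextAcq (P : Program X G V M N R) (t : TraceGraph X G V M N R) (a : M) (q q' : Node X V N) :
    Prop :=
  ∃ r, Releases P t a q r ∧ t.lk a r q'

/-- The mutex is held strictly before a release and not held at it, so neither of two releases can
come before the other. -/
theorem releases_unique (h : t.IsGlobalTrace P o) {a q r r'} (hr : Releases P t a q r)
    (hr' : Releases P t a q r') : r = r' := by
  obtain ⟨⟨z, e⟩, hs, hi, hall⟩ := hr
  obtain ⟨⟨z', e'⟩, hs', hi', hall'⟩ := hr'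
  have h1 := (h.raw.edge_mem e).2.1
  have h1' := (h.raw.edge_mem e').2.1
  rcases lt_trichotomy r.idx r'.idx with hlt | heq | hlt
  · exact absurd (hall' r h1 hs hi.le hlt) (h.not_holds_of_unlock e)
  · exact h.raw.node_ext h1 h1' (hs.trans hs'.symm) heq
  · exact absurd (hall r' h1' hs' hi'.le hlt) (h.not_holds_of_unlock e')

theorem nextAcq_rightUnique (h : t.IsGlobalTrace P o) (a : M) :
    Relator.RightUnique (NextAcq P t a) := by
  rintro q q₁ q₂ ⟨r₁, h1, l1⟩ ⟨r₂, h2, l2⟩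
  obtain rfl := h.releases_unique h1 h2
  exact h.lk_succ _ _ _ _ l1 l2

/-- The mutex is held when it is unlocked, so the acquisition from which it is held can be traced
back. The strict causal step from `q` to `r` makes the induction in `exists_chain` decrease. -/
theorem exists_releases (h : t.IsGlobalTrace P o) {a r} (hr : r ∈ t.rel a) :
    ∃ q ∈ t.acq a, Releases P t a q r ∧ t.Le q r ∧ q ≠ r := by
  obtain ⟨z, e⟩ := hr
  have h1 := h.raw.edge_mem e
  obtain ⟨-, q₀, q, hq, hs, hi, hall⟩ := h.exists_acquisition (h.unlock_held _ _ _ e)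
  have h2 := h.raw.edge_mem hq
  refine ⟨q, ⟨q₀, hq⟩, ⟨⟨z, e⟩, h1.2.2.2.1.trans hs.symm, by omega, fun m hm hms h3 h4 =>
    hall m hm (hms.trans hs) h3 (by omega)⟩, ?_, ?_⟩
  · exact h.raw.le_of_idx_le h2.2.1 h1.2.1 (hs.trans h1.2.2.2.1.symm) (by omega)
  · rintro rfl; omega

/-- All acquisitions of `a` lie on one chain. -/
theorem exists_chain (h : t.IsGlobalTrace P o) (hfin : t.nodes.Finite) {a q} (hq : q ∈ t.acq a) :
    ∃ b, t.lk a o b ∧ Relation.ReflTransGen (NextAcq P t a) b q := by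
  -- Induction on the size of the causal past: the `lk`-predecessor of `q` is the root or a release,
  -- and in the latter case the matching acquisition has a strictly smaller past, as it does not
  -- contain `q`.
  have key : ∀ n : ℕ, ∀ q ∈ t.acq a, {v ∈ t.nodes | t.Le v q}.ncard = n →
      ∃ b, t.lk a o b ∧ Relation.ReflTransGen (NextAcq P t a) b q := by
    intro n
    induction n using Nat.strong_induction_on with
    | _ n ih =>
      rintro q ⟨q₀, hq⟩ hn
      obtain ⟨z, hz, -⟩ := h.lk_pred a q ⟨q₀, hq⟩
      rcases (h.lk_dom _ _ _ hz).1 with hz' | rfl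
      · obtain ⟨p, hp, hpz, hle, hne⟩ := h.exists_releases hz'
        have hzq : t.Le z q := le_of_lk hz
        have hlt : {v ∈ t.nodes | t.Le v p}.ncard < n := by
          rw [← hn]
          refine Set.ncard_lt_ncard ?_ (hfin.subset (Set.sep_subset _ _))
          refine ⟨fun v hv => ⟨hv.1, hv.2.trans (hle.trans hzq)⟩, fun hsub => ?_⟩
          have h1 : t.Le q p := (hsub ⟨(h.raw.edge_mem hq).2.1, Relation.ReflTransGen.refl⟩).2
          exact hne (h.le_antisymm _ _ hle (hzq.trans h1))
        obtain ⟨b, hb, hbp⟩ := ih _ hlt p hp rfl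
        exact ⟨b, hb, hbp.tail ⟨z, hpz, hz⟩⟩
      · exact ⟨q, hz, Relation.ReflTransGen.refl⟩
  exact key _ q hq rfl

theorem le_of_nextAcq_chain (h : t.IsGlobalTrace P o) {a q q'} (hq : q ∈ t.acq a)
    (hc : Relation.ReflTransGen (NextAcq P t a) q q') : t.Le q q' := by
  induction hc with
  | refl => exact Relation.ReflTransGen.refl
  | @tail b c hb hbc ih =>
    obtain ⟨r, ⟨⟨z, e⟩, hs, hi, -⟩, hl⟩ := hbc
    have hbm : b ∈ t.nodes := by
      rcases Relation.ReflTransGen.cases_tail hb with rfl | ⟨d, -, r', -, hl'⟩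
      · obtain ⟨_, e'⟩ := hq; exact (h.raw.edge_mem e').2.1
      · obtain ⟨_, e'⟩ := (h.lk_dom _ _ _ hl').2; exact (h.raw.edge_mem e').2.1
    exact ih.trans ((h.raw.le_of_idx_le hbm (h.raw.edge_mem e).2.1 hs.symm hi.le).trans (le_of_lk hl))

/-- A mutex acquired twice has been released in between. -/
theorem acquisitions_ordered (h : t.IsGlobalTrace P o) (hfin : t.nodes.Finite) {a q q'}
    (hq : q ∈ t.acq a) (hq' : q' ∈ t.acq a) (hne : q ≠ q') :
    (∃ r, Releases P t a q r ∧ t.Le r q') ∨ ∃ r, Releases P t a q' r ∧ t.Le r q := by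
  have aux : ∀ {p p'}, p ≠ p' → Relation.ReflTransGen (NextAcq P t a) p p' →
      ∃ r, Releases P t a p r ∧ t.Le r p' := by
    intro p p' hne hc
    rcases Relation.ReflTransGen.cases_head hc with rfl | ⟨c, ⟨r, hr, hl⟩, hcp⟩
    · exact absurd rfl hne
    · exact ⟨r, hr, (le_of_lk hl).trans (h.le_of_nextAcq_chain (h.lk_dom _ _ _ hl).2 hcp)⟩
  obtain ⟨b, hb, hbq⟩ := h.exists_chain hfin hq
  obtain ⟨b', hb', hbq'⟩ := h.exists_chain hfin hq'
  -- The root has at most one `lk a`-successor, so both chains start at the same acquisition;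
  -- determinism then makes one an initial segment of the other.
  obtain rfl := h.lk_succ _ _ _ _ hb hb'
  exact (Relation.ReflTransGen.total_of_right_unique (h.nextAcq_rightUnique a) hbq hbq').imp
    (aux hne) (aux hne.symm)

/-- If different threads hold `a` at the nodes `m` and `n`, then one of them releases it before the
other one acquires it. -/
theorem mutual_exclusion (h : t.IsGlobalTrace P o) (hfin : t.nodes.Finite) {a m n}
    (hm : t.Holds a m) (hn : t.Holds a n) (hne : m.st P.self ≠ n.st P.self) :
    (∃ r ∈ t.rel a, ∃ q₀ q, r.st P.self = m.st P.self ∧ m.idx < r.idx ∧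
      (q₀, Act.lock a, q) ∈ t.edges ∧ q.st P.self = n.st P.self ∧ q.idx ≤ n.idx ∧ t.Le r q) ∨
    (∃ r ∈ t.rel a, ∃ q₀ q, r.st P.self = n.st P.self ∧ n.idx < r.idx ∧
      (q₀, Act.lock a, q) ∈ t.edges ∧ q.st P.self = m.st P.self ∧ q.idx ≤ m.idx ∧ t.Le r q) := by
  obtain ⟨-, p₀, p, hp, hps, hpi, hpall⟩ := h.exists_acquisition hm
  obtain ⟨-, q₀, q, hq, hqs, hqi, hqall⟩ := h.exists_acquisition hn
  have hpq : p ≠ q := by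
    rintro rfl; exact hne (hps.symm.trans hqs)
  rcases h.acquisitions_ordered hfin ⟨p₀, hp⟩ ⟨q₀, hq⟩ hpq with
    ⟨r, ⟨⟨z, e⟩, hs, hi, -⟩, hle⟩ | ⟨r, ⟨⟨z, e⟩, hs, hi, -⟩, hle⟩
  · refine Or.inl ⟨r, ⟨z, e⟩, q₀, q, hs.trans hps, ?_, hq, hqs, hqi, hle⟩
    -- A release at or before `m` would lie in the stretch from `p` to `m` throughout which `a` is
    -- held.
    by_contra hc
    exact h.not_holds_of_unlock e
      (hpall r (h.raw.edge_mem e).2.1 (hs.trans hps) hi.le (by omega))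
  · refine Or.inr ⟨r, ⟨z, e⟩, p₀, p, hs.trans hqs, ?_, hp, hps, hpi, hle⟩
    by_contra hc
    exact h.not_holds_of_unlock e
      (hqall r (h.raw.edge_mem e).2.1 (hs.trans hqs) hi.le (by omega))

end IsGlobalTrace
end TraceGraph

/-! ### Subtraces -/

namespace TraceGraph
variable {X G V M N R : Type u} {P : Program X G V M N R} {t t' : TraceGraph X G V M N R}

/-- The nodes and edges of `t'` are nodes and edges of `t`. -/
structure IsSub (t' t : TraceGraph X G V M N R) : Prop where
  nodes : t'.nodes ⊆ t.nodes
  edges : t'.edges ⊆ t.edges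

theorem IsSub.refl (t : TraceGraph X G V M N R) : t.IsSub t := ⟨subset_rfl, subset_rfl⟩

theorem IsSub.trans {t'' : TraceGraph X G V M N R} (h : t''.IsSub t') (h' : t'.IsSub t) :
    t''.IsSub t :=
  ⟨h.nodes.trans h'.nodes, h.edges.trans h'.edges⟩

variable [DecidableEq X]

theorem IsSub.mem_edges (hs : t'.IsSub t) (h' : t'.IsRawGlobal P) (h : t.IsRawGlobal P) {z A v}
    (e : (z, A, v) ∈ t.edges) (hv : v ∈ t'.nodes) : (z, A, v) ∈ t'.edges := by
  obtain ⟨z', A', e'⟩ := h'.exists_pred hv (by have := (h.edge_mem e).2.2.1; omega)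
  obtain ⟨rfl, rfl⟩ := h.pred_unique e (hs.edges e')
  exact e'

/-- Both graphs consist of gapless threads starting at index 0, so a subtrace contains the whole
past of its nodes within their thread. Locksets therefore agree in trace and subtrace. -/
theorem IsSub.mem_nodes (hs : t'.IsSub t) (h' : t'.IsRawGlobal P) (h : t.IsRawGlobal P) {n v}
    (hn : n ∈ t.nodes) (hv : v ∈ t'.nodes) (hself : n.st P.self = v.st P.self)
    (hi : n.idx ≤ v.idx) : n ∈ t'.nodes := by
  obtain ⟨z, hz, hzs, hzi⟩ := h'.exists_node hv hi
  rwa [h.node_ext hn (hs.nodes hz) (hself.trans hzs.symm) hzi.symm]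

theorem IsSub.holds_iff (hs : t'.IsSub t) (h' : t'.IsRawGlobal P) (h : t.IsRawGlobal P) {a v}
    (hv : v ∈ t'.nodes) : t.Holds a v ↔ t'.Holds a v := by
  constructor
  · intro hh
    induction hh with
    | acquire e => exact .acquire (hs.mem_edges h' h e hv)
    | keep e hA _ ih =>
      have e' := hs.mem_edges h' h e hv
      exact .keep e' hA (ih (h'.edge_mem e').1)
  · intro hh
    induction hh with
    | acquire e => exact .acquire (hs.edges e)
    | keep e hA _ ih => exact .keep (hs.edges e) hA (ih (h'.edge_mem e).1)

theorem IsSub.lockset_eq (hs : t'.IsSub t) (h' : t'.IsRawGlobal P) (h : t.IsRawGlobal P) {v}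
    (hv : v ∈ t'.nodes) : t.lockset v = t'.lockset v :=
  Set.ext fun _ => hs.holds_iff h' h hv

theorem IsRawGlobal.lockset_edge (h : t.IsRawGlobal P) {z A v} (e : (z, A, v) ∈ t.edges) :
    t.lockset v = A.lockset (t.lockset z) := by
  have key : ∀ a, t.Holds a v ↔ A = .lock a ∨ A ≠ .unlock a ∧ t.Holds a z := by
    intro a
    constructor
    · intro hh
      cases hh with
      | acquire e' => exact Or.inl (h.pred_unique e e').2
      | keep e' hA hz =>
        obtain ⟨rfl, rfl⟩ := h.pred_unique e e'
        exact Or.inr ⟨hA, hz⟩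
    · rintro (rfl | ⟨hA, hz⟩)
      · exact .acquire e
      · exact .keep e hA hz
  ext a
  refine (key a).trans ?_
  cases A <;> simp [Act.lockset, lockset, eq_comm, and_comm]

theorem IsRawGlobal.lockset_of_idx_zero (h : t.IsRawGlobal P) {v} (h0 : v.idx = 0) :
    t.lockset v = ∅ := by
  refine Set.eq_empty_of_forall_notMem fun a ha => ?_
  cases ha with
  | acquire e => have := (h.edge_mem e).2.2.1; omega
  | keep e => have := (h.edge_mem e).2.2.1; omega

end TraceGraph

/-! ### The ego thread -/

namespace LocalTrace
open TraceGraph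
variable {X G V M N R : Type u} [DecidableEq X] {P : Program X G V M N R} {t t₀ : LocalTrace P}

theorem raw (t : LocalTrace P) : t.1.IsRawGlobal P := t.2.1.elim fun _ h => h.raw

theorem le_antisymm (t : LocalTrace P) {v v'} (h : t.1.Le v v') (h' : t.1.Le v' v) : v = v' :=
  t.2.1.elim fun _ hg => hg.le_antisymm _ _ h h'

/-- A later node of the ego thread would be causally both above and below the sink. -/
theorem idx_le_sink (t : LocalTrace P) {n} (hn : n ∈ t.1.nodes) (hs : n.st P.self = t.id) :
    n.idx ≤ t.1.sink.idx := by
  by_contra hc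
  have h1 := t.raw.le_of_idx_le t.2.2.1 hn hs.symm (by omega)
  rw [t.le_antisymm h1 (t.2.2.2 n hn)] at hc
  exact hc le_rfl

theorem noTlWrite_or_exists_last (hfin : t.1.nodes.Finite) (g : G) :
    t.NoTlWrite g ∨ ∃ v x v', t.LastTlWrite g v x v' := by
  by_cases hn : t.NoTlWrite g
  · exact Or.inl hn
  · right
    simp only [NoTlWrite, not_forall, not_not] at hn
    obtain ⟨z, y, z', e, hz⟩ := hn
    obtain ⟨m, ⟨-, v, x, em, hv⟩, hmax⟩ := Set.exists_max_image
      {n | n ∈ t.1.nodes ∧ ∃ z y, (z, Act.write g y, n) ∈ t.1.edges ∧ z.st P.self = t.id}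
      Node.idx (hfin.subset fun _ h => h.1) ⟨z', (t.raw.edge_mem e).2.1, z, y, e, hz⟩
    exact ⟨v, x, m, em, hv, fun z y z' e' hz' => hmax z' ⟨(t.raw.edge_mem e').2.1, z, y, e', hz'⟩⟩

/-- `t` prolongs the ego thread of `t₀` by the action `A`. -/
structure Prolongs (t₀ : LocalTrace P) (A : Act X G M N R) (t : LocalTrace P) : Prop where
  sub : t₀.1.IsSub t.1
  edge : (t₀.1.sink, A, t.1.sink) ∈ t.1.edges

namespace Prolongs
variable {A : Act X G M N R}

theorem id_eq (h : Prolongs t₀ A t) : t.id = t₀.id := (t.raw.edge_mem h.edge).2.2.2.1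

theorem idx_eq (h : Prolongs t₀ A t) : t.1.sink.idx = t₀.1.sink.idx + 1 :=
  (t.raw.edge_mem h.edge).2.2.1

theorem cfg_edge (h : Prolongs t₀ A t) : (t₀.loc, A, t.loc) ∈ P.edges :=
  (t.raw.edge_mem h.edge).2.2.2.2.1

theorem step (h : Prolongs t₀ A t) : P.Step A t₀.1.sink.st t.1.sink.st :=
  (t.raw.edge_mem h.edge).2.2.2.2.2

/-- For a lock, `t` also contains a merged second trace, which may include nodes of the ego thread.
Those other than the sink have index at most that of the sink of `t₀` and hence already belong to
`t₀`. -/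
theorem ego_node (h : Prolongs t₀ A t) {n} (hn : n ∈ t.1.nodes) (hs : n.st P.self = t.id) :
    n = t.1.sink ∨ n ∈ t₀.1.nodes := by
  have h1 := t.idx_le_sink hn hs
  by_cases hi : n.idx = t.1.sink.idx
  · exact Or.inl (t.raw.node_ext hn t.2.2.1 hs hi)
  · right
    have := h.idx_eq
    exact h.sub.mem_nodes t₀.raw t.raw hn t₀.2.2.1 (hs.trans h.id_eq) (by omega)

theorem ego_edge (h : Prolongs t₀ A t) {z B v} (e : (z, B, v) ∈ t.1.edges)
    (hs : z.st P.self = t.id) :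
    (z = t₀.1.sink ∧ B = A ∧ v = t.1.sink) ∨ (z, B, v) ∈ t₀.1.edges := by
  have h1 := t.raw.edge_mem e
  rcases h.ego_node h1.2.1 (h1.2.2.2.1.trans hs) with rfl | hv
  · obtain ⟨rfl, rfl⟩ := t.raw.pred_unique e h.edge
    exact Or.inl ⟨rfl, rfl, rfl⟩
  · exact Or.inr (h.sub.mem_edges t₀.raw t.raw e hv)

theorem lockset_eq (h : Prolongs t₀ A t) {v} (hv : v ∈ t₀.1.nodes) :
    t.1.lockset v = t₀.1.lockset v :=
  h.sub.lockset_eq t₀.raw t.raw hv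

theorem locks_eq (h : Prolongs t₀ A t) : t.locks = A.lockset t₀.locks := by
  rw [locks, t.raw.lockset_edge h.edge, h.lockset_eq t₀.2.2.1]; rfl

theorem lastTlWrite_iff (h : Prolongs t₀ A t) {g v x v'} (hA : ∀ y, A ≠ .write g y) :
    t.LastTlWrite g v x v' ↔ t₀.LastTlWrite g v x v' := by
  have key : ∀ {z y z'}, z.st P.self = t.id →
      ((z, Act.write g y, z') ∈ t.1.edges ↔ (z, Act.write g y, z') ∈ t₀.1.edges) := by
    intro z y z' hz
    refine ⟨fun e => ?_, fun e => h.sub.edges e⟩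
    rcases h.ego_edge e hz with ⟨-, hB, -⟩ | e'
    · exact absurd hB.symm (hA y)
    · exact e'
  unfold LastTlWrite
  rw [← h.id_eq]
  constructor
  · rintro ⟨e, hv, hm⟩
    exact ⟨(key hv).1 e, hv, fun z y z' e' hz => hm z y z' ((key hz).2 e') hz⟩
  · rintro ⟨e, hv, hm⟩
    exact ⟨(key hv).2 e, hv, fun z y z' e' hz => hm z y z' ((key hz).1 e') hz⟩

theorem noTlWrite (h : Prolongs t₀ A t) {g} (hn : t.NoTlWrite g) : t₀.NoTlWrite g :=
  fun z y z' e => h.id_eq ▸ hn z y z' (h.sub.edges e)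

theorem lastTlWrite_write {g : G} {x : X} (h : Prolongs t₀ (.write g x) t) {v y v'}
    (hl : t.LastTlWrite g v y v') : v = t₀.1.sink ∧ y = x ∧ v' = t.1.sink := by
  obtain ⟨e, hv, hm⟩ := hl
  have h1 := hm _ _ _ h.edge h.id_eq.symm
  have h2 := t.raw.edge_mem e
  have h3 := t.idx_le_sink h2.2.1 (h2.2.2.2.1.trans hv)
  obtain rfl := t.raw.node_ext h2.2.1 t.2.2.1 (h2.2.2.2.1.trans hv) (by omega)
  obtain ⟨rfl, h4⟩ := t.raw.pred_unique e h.edge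
  simp only [Act.write.injEq, true_and] at h4
  exact ⟨rfl, h4, rfl⟩

end Prolongs
end LocalTrace

/-! ### Upward-closed sets of locksets -/

namespace UpLocks
variable {M : Type u}

theorem mem_sets_of_subset {U : UpLocks M} {S T : Set M} (h : S ⊆ T) (hS : S ∈ U.sets) :
    T ∈ U.sets :=
  (OrderDual.ofDual U : UpperSet (Set M)).upper h hS

theorem closure_le {B : Set (Set M)} {U : UpLocks M} : closure B ≤ U ↔ B ⊆ U.sets :=
  le_upperClosure

theorem mem_of_le {U U' : UpLocks M} (h : U ≤ U') {S} (hS : S ∈ U.sets) : S ∈ U'.sets := h hS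

theorem mem_single {S T : Set M} : T ∈ (single S).sets ↔ S ⊆ T := Iff.rfl

/-- Finiteness of `M` enters here: it lets the constraints, which mention only minimal elements,
account for all members. -/
theorem exists_mins_subset [Finite M] {U : UpLocks M} {S : Set M} (hS : S ∈ U.sets) :
    ∃ T ∈ U.mins, T ⊆ S := by
  obtain ⟨T, hT, hm⟩ := exists_minimal_le_of_wellFoundedLT (· ∈ U.sets) S hS
  exact ⟨T, hm, hT⟩

end UpLocks

/-! ### The abstraction along prolongations -/

namespace LocalTrace
open TraceGraph
variable {X G V M N R : Type u} [DecidableEq X] {P : Program X G V M N R} {t t₀ : LocalTrace P}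

theorem betaW_le {g : G} {U : UpLocks M} :
    t.betaW g ≤ U ↔ ∀ v x v', t.LastTlWrite g v x v' → t.1.lockset v' ∈ U.sets := by
  rw [betaW, UpLocks.closure_le]
  constructor
  · intro h v x v' hl
    exact h ⟨v, x, v', hl, rfl⟩
  · rintro h _ ⟨v, x, v', hl, rfl⟩
    exact h v x v' hl

theorem betaP_le {g : G} {U : UpLocks M} :
    t.betaP g ≤ U ↔ (t.NoTlWrite g → ∅ ∈ U.sets) ∧ ∀ v x v', t.LastTlWrite g v x v' →
      ∀ y ∈ t.1.nodes, y.st P.self = t.id → v'.idx ≤ y.idx → t.1.lockset y ∈ U.sets := by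
  rw [betaP, UpLocks.closure_le]
  constructor
  · intro h
    refine ⟨fun hn => h (Or.inl ⟨hn, rfl⟩), fun v x v' hl y hy hs hi => h (Or.inr ⟨v, x, v', hl, ?_⟩)⟩
    exact subset_upperClosure ⟨y, hy, hs, hi, rfl⟩
  · rintro ⟨h1, h2⟩ L (⟨hn, rfl⟩ | ⟨v, x, v', hl, hL⟩)
    · exact h1 hn
    · obtain ⟨_, ⟨y, hy, hs, hi, rfl⟩, hyL⟩ := hL
      exact UpLocks.mem_sets_of_subset hyL (h2 v x v' hl y hy hs hi)

namespace Prolongs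
variable {A : Act X G M N R}

theorem betaW_le (h : Prolongs t₀ A t) {g : G} (hA : ∀ y, A ≠ .write g y) {U : UpLocks M}
    (hU : t₀.betaW g ≤ U) : t.betaW g ≤ U := by
  rw [LocalTrace.betaW_le] at hU ⊢
  intro v x v' hl
  rw [h.lastTlWrite_iff hA] at hl
  rw [h.lockset_eq (t₀.raw.edge_mem hl.1).2.1]
  exact hU v x v' hl

/-- The only new lockset in the history is the one at the new sink. The hypothesis `hS` lets each
action justify it in its own way: by equality, by upward closure, or by an explicit join. -/
theorem betaP_le (h : Prolongs t₀ A t) {g : G} (hA : ∀ y, A ≠ .write g y) {U : UpLocks M}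
    (hU : t₀.betaP g ≤ U) (hS : t₀.locks ∈ U.sets → t.locks ∈ U.sets) : t.betaP g ≤ U := by
  rw [LocalTrace.betaP_le] at hU ⊢
  refine ⟨fun hn => hU.1 (h.noTlWrite hn), fun v x v' hl y hy hs hi => ?_⟩
  rw [h.lastTlWrite_iff hA] at hl
  rcases h.ego_node hy hs with rfl | hy'
  · have h1 := t₀.raw.edge_mem hl.1
    exact hS (hU.2 v x v' hl _ t₀.2.2.1 rfl (t₀.idx_le_sink h1.2.1 (h1.2.2.2.1.trans hl.2.1)))
  · rw [h.lockset_eq hy']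
    exact hU.2 v x v' hl y hy' (hs.trans h.id_eq) hi

theorem betaVal_inr (h : Prolongs t₀ A t) {g : G} (hA : ∀ y, A ≠ .write g y) :
    t.betaVal (.inr g) = t₀.betaVal (.inr g) := by
  simp only [betaVal, h.lastTlWrite_iff hA]

end Prolongs

/-! ### Reading a value written by another thread -/

/-- Suppose the ego thread is about to access `g`, and the most recent write to `g` is by another
thread. After this write, the other thread has released a mutex held by the ego thread, and then
shares no mutex with the ego thread; meanwhile, the ego thread has not always held that mutex, nor
has it always held some mutex held at the write. -/
theorem exists_unlock_of_foreign_write (hP : P.WellFormed) (hfin : t.1.nodes.Finite)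
    {B : Act X G M N R} {u' : N} {g : G} (hB : (t.loc, B, u') ∈ P.edges) (hBg : B.Accesses g)
    {z y z'} (hw : (z, Act.write g y, z') ∈ t.1.edges)
    (hmax : ∀ z₂ y₂ z₂', (z₂, Act.write g y₂, z₂') ∈ t.1.edges → t.1.Le z' z₂' → z₂' = z')
    (hne : z.st P.self ≠ t.id) :
    ∃ a ∈ t.locks, ∃ r₀ r, (r₀, Act.unlock a, r) ∈ t.1.edges ∧ r.st P.self = z.st P.self ∧
      z'.idx < r.idx ∧ t.locks ∩ t.1.lockset r = ∅ ∧
      ∀ v x v', t.LastTlWrite g v x v' →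
        (∃ n ∈ t.1.nodes, n.st P.self = t.id ∧ v'.idx ≤ n.idx ∧
          t.1.lockset n ∩ t.1.lockset z' = ∅) ∧
        ∃ n ∈ t.1.nodes, n.st P.self = t.id ∧ v'.idx ≤ n.idx ∧ a ∉ t.1.lockset n := by
  obtain ⟨o, hg⟩ := t.2.1
  have hz := t.raw.edge_mem hw
  have hzs : z'.st P.self = z.st P.self := hz.2.2.2.1
  have no_release : ∀ r b, r ∈ t.1.rel b → r.st P.self = t.1.sink.st P.self →
      ¬ t.1.sink.idx < r.idx := by
    rintro r b ⟨r₀, e⟩ hs hi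
    have := t.idx_le_sink (t.raw.edge_mem e).2.1 hs
    omega
  -- Choose the last release by the writer, after its write, of any mutex held at the sink.
  -- Candidates exist: `m_g` is held both after the write and at the sink, and the ego thread has no
  -- release beyond the sink.
  obtain ⟨r, ⟨-, hrs, hri, a, ha, r₀, er⟩, hrmax⟩ := Set.exists_max_image
    {r | r ∈ t.1.nodes ∧ r.st P.self = z.st P.self ∧ z'.idx < r.idx ∧ ∃ a ∈ t.locks, r ∈ t.1.rel a}
    Node.idx (hfin.subset fun _ h => h.1) (by
      have hm := hg.holds_of_access hP t.2.2.1 hB hBg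
      rcases hg.mutual_exclusion hfin (hg.holds_of_write hP hw) hm (hzs.trans_ne hne) with
        ⟨r, hr, _, _, hs, hi, _⟩ | ⟨r, hr, _, _, hs, hi, _⟩
      · obtain ⟨r₀, e⟩ := _root_.id hr
        exact ⟨r, (t.raw.edge_mem e).2.1, hs.trans hzs, hi, _, hm, hr⟩
      · exact absurd hi (no_release r _ hr hs))
  have hr := t.raw.edge_mem er
  refine ⟨a, ha, r₀, r, er, hrs, hri, ?_, ?_⟩
  -- A common mutex `b` would have to be released by the writer after `r`, against the choice of
  -- `r`, or by the ego thread after its sink.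
  · refine Set.eq_empty_of_forall_notMem fun b ⟨hb, hbr⟩ => ?_
    rcases hg.mutual_exclusion hfin hbr hb (hrs.trans_ne hne) with
      ⟨r', hr', _, _, hs, hi, _⟩ | ⟨r', hr', _, _, hs, hi, _⟩
    · obtain ⟨_, e⟩ := _root_.id hr'
      have := hrmax r' ⟨(t.raw.edge_mem e).2.1, hs.trans hrs, by omega, b, hb, hr'⟩
      omega
    · exact absurd hi (no_release r' _ hr' hs)
  · rintro v x v' ⟨ev, hvs, -⟩
    have hv := t.raw.edge_mem ev
    have hvs' : v'.st P.self = t.id := hv.2.2.2.1.trans hvs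
    have hvz_ne : v' ≠ z' := by
      rintro rfl; exact hne (hzs.symm.trans hvs')
    -- Mutual exclusion on `m_g` orders the two writes; the opposite order contradicts the
    -- maximality of `z'`.
    have hvz : t.1.Le v' z' := by
      rcases hg.mutual_exclusion hfin (hg.holds_of_write hP ev) (hg.holds_of_write hP hw)
        (by rw [hvs', hzs]; exact hne.symm) with
        ⟨r', ⟨_, e⟩, _, q, hs, hi, eq, hqs, hqi, hle⟩ | ⟨r', ⟨_, e⟩, _, q, hs, hi, eq, hqs, hqi, hle⟩
      · exact (t.raw.le_of_idx_le hv.2.1 (t.raw.edge_mem e).2.1 hs.symm hi.le).trans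
          (hle.trans (t.raw.le_of_idx_le (t.raw.edge_mem eq).2.1 hz.2.1 hqs hqi))
      · refine absurd (hmax _ _ _ ev ?_) hvz_ne
        exact (t.raw.le_of_idx_le hz.2.1 (t.raw.edge_mem e).2.1 hs.symm hi.le).trans
          (hle.trans (t.raw.le_of_idx_le (t.raw.edge_mem eq).2.1 hv.2.1 hqs hqi))
    constructor
    -- Take the last ego node `n` below the foreign write. A mutex held at both `n` and `z'` would
    -- be released either by the ego thread after `n` yet below `z'`, against the choice of `n`, or
    -- by the writer after `z'` yet below `n`, a cycle.
    · obtain ⟨n, ⟨hn, hns, hnz⟩, hnmax⟩ := Set.exists_max_image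
        {n | n ∈ t.1.nodes ∧ n.st P.self = t.id ∧ t.1.Le n z'}
        Node.idx (hfin.subset fun _ h => h.1) ⟨v', hv.2.1, hvs', hvz⟩
      refine ⟨n, hn, hns, hnmax v' ⟨hv.2.1, hvs', hvz⟩, ?_⟩
      refine Set.eq_empty_of_forall_notMem fun b ⟨hbn, hbz⟩ => ?_
      rcases hg.mutual_exclusion hfin hbn hbz (by rw [hns, hzs]; exact hne.symm) with
        ⟨r', ⟨_, e⟩, _, q, hs, hi, eq, hqs, hqi, hle⟩ | ⟨r', ⟨_, e⟩, _, q, hs, hi, eq, hqs, hqi, hle⟩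
      · have := hnmax r' ⟨(t.raw.edge_mem e).2.1, hs.trans hns,
          hle.trans (t.raw.le_of_idx_le (t.raw.edge_mem eq).2.1 hz.2.1 hqs hqi)⟩
        omega
      · have h1 : t.1.Le r' z' :=
          hle.trans ((t.raw.le_of_idx_le (t.raw.edge_mem eq).2.1 hn hqs hqi).trans hnz)
        have h2 := t.raw.le_of_idx_le hz.2.1 (t.raw.edge_mem e).2.1 hs.symm hi.le
        rw [t.le_antisymm h1 h2] at hi
        exact lt_irrefl _ hi
    -- Mutual exclusion is applied at `r₀`, where `a` is still held. It yields an acquisition `q` of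
    -- `a` by the ego thread causally after `r`, hence after `v'`; its predecessor `q₀` is at or
    -- after `v'` and does not hold `a`, as mutexes are not re-entrant.
    · have hr₀ : t.1.Holds a r₀ := hg.unlock_held _ _ _ er
      rcases hg.mutual_exclusion hfin hr₀ ha (by rw [← hr.2.2.2.1, hrs]; exact hne) with
        ⟨r', ⟨_, e⟩, q₀, q, hs, hi, eq, hqs, hqi, hle⟩ | ⟨r', hr', _, _, hs, hi, _⟩
      · have hq := t.raw.edge_mem eq
        have hzr : t.1.Le z' r := t.raw.le_of_idx_le hz.2.1 hr.2.1 (hzs.trans hrs.symm) hri.le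
        have hrr' : t.1.Le r r' := t.raw.le_of_idx_le hr.2.1 (t.raw.edge_mem e).2.1
          (hr.2.2.2.1.trans hs.symm) (by omega)
        have hzq : t.1.Le z' q := hzr.trans (hrr'.trans hle)
        have hvq : v' ≠ q := by
          rintro rfl; exact hvz_ne (t.le_antisymm hvz hzq)
        have := hg.idx_lt_of_le hv.2.1 hq.2.1 (hvs'.trans hqs.symm) (hvz.trans hzq) hvq
        exact ⟨q₀, hq.1, hq.2.2.2.1.symm.trans hqs, by omega, hg.lock_free _ _ _ eq⟩
      · exact absurd hi (no_release r' _ hr' hs)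

end LocalTrace

/-! ### Soundness of Write-Centered Reading -/

section Soundness
set_option linter.unusedSectionVars false
open LocalTrace TraceGraph
variable {X G V M N R D : Type u} [DecidableEq X] [DecidableEq G] [CompleteLattice D]
  {P : Program X G V M N R} {ν : LocalTrace P → P.tids} {Dm : AbsDomain X G V M N R D}
  {η₃ : ∀ x, AbsVal X G M N D x} {t t₀ : LocalTrace P}

/-- The state assigned to the unknown `[u, S]`. -/
def ptVal (η₃ : ∀ x, AbsVal X G M N D x) (u : N) (S : Set M) : AbsState X G M D := η₃ (.pt u S)

/-- The value assigned to the unknown `[g, a, S, w]`. -/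
def globVal (η₃ : ∀ x, AbsVal X G M N D x) (g : G) (a : M) (S w : Set M) : D := η₃ (.glob g a S w)

/-- The abstract value obtained when `g` is read at `[u, S]`. -/
def readVal (η₃ : ∀ x, AbsVal X G M N D x) (u : N) (S : Set M) (g : G) : D :=
  (ptVal η₃ u S).2.2 (.inr g) ⊔
    sSup {d | ∃ a S' w, a ∈ S ∧ S ∩ S' = ∅ ∧
      (∃ S'' ∈ ((ptVal η₃ u S).2.1 g).mins, S'' ∩ w = ∅) ∧
      (∃ S''' ∈ ((ptVal η₃ u S).2.1 g).mins, a ∉ S''') ∧ d = globVal η₃ g a S' w}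

/-! ### Descriptions along the abstract constraints -/

theorem absSystem_edge (hη₃ : IsSolution (absSystem P Dm) η₃) {u A u'} (e : (u, A, u') ∈ P.edges)
    (S : Set M) : (∀ x, (absRhs P Dm u S A η₃).1 x ≤ η₃ x) ∧
      (absRhs P Dm u S A η₃).2 ≤ ptVal η₃ u' (A.lockset S) :=
  hη₃ _ (Or.inr ⟨u, A, u', S, e, rfl⟩)

/-- A local trace is described by the values of the unknowns to which it contributes. -/
structure IsDescribed (ν : LocalTrace P → P.tids) (Dm : AbsDomain X G V M N R D)
    (η₃ : ∀ x, AbsVal X G M N D x) (t : LocalTrace P) : Prop where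
  pt : t ∈ gammaPt ν Dm.γ t.loc t.locks (ptVal η₃ t.loc t.locks)
  glob : ∀ a g v x v', t.LastIs (.unlock a) → t.LastTlWrite g v x v' →
    ∃ w ⊆ t.1.lockset v', v.st x ∈ Dm.γ (globVal η₃ g a t.locks w)

/-- Shared by initial traces and freshly created threads: at index 0 the ego thread has neither
written a global nor acquired a mutex. -/
theorem isDescribed_of_idx_zero (h0 : t.1.sink.idx = 0) (hr : Reachable ν t)
    (hQ : ∀ g, ∅ ∈ ((ptVal η₃ t.loc ∅).2.1 g).sets)
    (hσ : ∀ x, t.1.sink.st x ∈ Dm.γ ((ptVal η₃ t.loc ∅).2.2 (.inl x))) :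
    IsDescribed ν Dm η₃ t := by
  have hl : t.locks = ∅ := t.raw.lockset_of_idx_zero h0
  have hno : ∀ {g v x v'}, ¬ t.LastTlWrite g v x v' := by
    rintro g v x v' ⟨e, hs, -⟩
    have h1 := t.raw.edge_mem e
    have h2 := t.idx_le_sink h1.2.1 (h1.2.2.2.1.trans hs)
    omega
  refine ⟨⟨⟨hr, rfl⟩, rfl, fun g => ?_, fun g => ?_, ?_⟩, fun a g v x v' _ hw => absurd hw hno⟩
  · exact betaW_le.2 fun v x v' hw => absurd hw hno
  · rw [hl]
    exact betaP_le.2 ⟨fun _ => hQ g, fun v x v' hw => absurd hw hno⟩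
  · rintro (x | g)
    · rw [hl]
      rintro _ rfl
      exact hσ x
    · rintro _ ⟨v, x, v', hw, -⟩
      exact absurd hw hno

theorem mem_gammaPt_of_prolongs {A : Act X G M N R} (h : Prolongs t₀ A t) (hr : Reachable ν t)
    (hA : ∀ g y, A ≠ .write g y) {u S} {s s' : AbsState X G M D}
    (ht : t₀ ∈ gammaPt ν Dm.γ u S s) (hW : s.1 ≤ s'.1) (hQ : s.2.1 ≤ s'.2.1)
    (hS : ∀ g, t₀.locks ∈ (s'.2.1 g).sets → t.locks ∈ (s'.2.1 g).sets)
    (hX : ∀ x, t.1.sink.st x ∈ Dm.γ (s'.2.2 (.inl x)))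
    (hG : ∀ g, t₀.betaVal (.inr g) ⊆ Dm.γ (s'.2.2 (.inr g))) :
    t ∈ gammaPt ν Dm.γ t.loc t.locks s' := by
  refine ⟨⟨hr, rfl⟩, rfl, fun g => ?_, fun g => ?_, ?_⟩
  · exact h.betaW_le (hA g) ((ht.2.2.1 g).trans (hW g))
  · exact h.betaP_le (hA g) ((ht.2.2.2.1 g).trans (hQ g)) (hS g)
  · rintro (x | g)
    · rintro _ rfl
      exact hX x
    · rw [h.betaVal_inr (hA g)]
      exact hG g

/-- The lockset of the last write belongs to `W g` and so contains a minimal `w`; the side-effect of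
the `unlock` on that `w` carries the value written. -/
theorem glob_of_prolongs [Finite M] (hγ : Monotone Dm.γ) (hη₃ : IsSolution (absSystem P Dm) η₃)
    {A : Act X G M N R} (h : Prolongs t₀ A t) (ht : IsDescribed ν Dm η₃ t₀) {a g v x v'}
    (hl : t.LastIs (.unlock a)) (hw : t.LastTlWrite g v x v') :
    ∃ w ⊆ t.1.lockset v', v.st x ∈ Dm.γ (globVal η₃ g a t.locks w) := by
  obtain ⟨z, e⟩ := hl
  obtain ⟨-, rfl⟩ := t.raw.pred_unique h.edge e
  rw [h.lastTlWrite_iff (by simp)] at hw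
  rw [h.lockset_eq (t₀.raw.edge_mem hw.1).2.1]
  obtain ⟨w, hwm, hws⟩ := UpLocks.exists_mins_subset (betaW_le.1 (ht.pt.2.2.1 g) v x v' hw)
  refine ⟨w, hws, hγ ?_ (ht.pt.2.2.2.2 (.inr g) ⟨v, x, v', hw, rfl⟩)⟩
  have hc := (absSystem_edge hη₃ h.cfg_edge t₀.locks).1 (.glob g a t.locks w)
  refine le_trans ?_ hc
  exact le_iSup (fun _ : a = a ∧ t.locks = t₀.locks \ {a} ∧
    w ∈ ((ptVal η₃ t₀.loc t₀.locks).1 g).mins => (ptVal η₃ t₀.loc t₀.locks).2.2 (.inr g))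
    ⟨rfl, h.locks_eq, hwm⟩

theorem mem_update_of_mem {x : X} {σ : X → V} {σs : X ⊕ G → D} {γ : D → Set V} {d : V} {ds : D}
    [DecidableEq (X ⊕ G)] (hσ : ∀ y, σ y ∈ γ (σs (.inl y))) (hd : d ∈ γ ds) (y : X) :
    Function.update σ x d y ∈ γ (Function.update σs (.inl x) ds (.inl y)) := by
  by_cases hy : y = x
  · subst hy; simpa using hd
  · simpa [hy] using hσ y

/-- `Step` leaves the created id and the value read arbitrary, so both are constrained by separate
hypotheses. The other effects are determined by `Step`. -/
theorem pt_of_prolongs (hDm : Dm.Admissible ν) (hη₃ : IsSolution (absSystem P Dm) η₃)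
    {A : Act X G M N R} (h : Prolongs t₀ A t) (hr : Reachable ν t) (ht : IsDescribed ν Dm η₃ t₀)
    (hcreate : ∀ x u₁, A = .create x u₁ → t.1.sink.st x = ν t₀)
    (hread : ∀ x g, A = .read x g → t.1.sink.st x ∈ Dm.γ (readVal η₃ t₀.loc t₀.locks g)) :
    t ∈ gammaPt ν Dm.γ t.loc t.locks (ptVal η₃ t.loc t.locks) := by
  have hst := h.step
  have hloc := h.locks_eq
  have hX : ∀ x, t₀.1.sink.st x ∈ Dm.γ ((ptVal η₃ t₀.loc t₀.locks).2.2 (.inl x)) :=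
    fun x => ht.pt.2.2.2.2 (.inl x) rfl
  have hG : ∀ g, t₀.betaVal (.inr g) ⊆ Dm.γ ((ptVal η₃ t₀.loc t₀.locks).2.2 (.inr g)) :=
    fun g => ht.pt.2.2.2.2 (.inr g)
  have hc := (absSystem_edge hη₃ h.cfg_edge t₀.locks).2
  rw [← hloc] at hc
  cases A with
  | guard r =>
    obtain ⟨hW, hQ, hσ⟩ := hc
    obtain ⟨h1, h2⟩ := hDm.guardT_spec r _ (fun g => t₀.betaVal (.inr g)) _ hst.1 hX hG
    refine mem_gammaPt_of_prolongs h hr (by simp) ht.pt hW hQ (fun g hS => hloc ▸ hS)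
      (fun x => ?_) fun g => (h2 g).trans (hDm.γ_mono (hσ _))
    rw [hst.2]
    exact hDm.γ_mono (hσ _) (h1 x)
  | assign y r =>
    obtain ⟨hW, hQ, hσ⟩ := hc
    obtain ⟨h1, h2⟩ := hDm.assignT_spec y r _ (fun g => t₀.betaVal (.inr g)) _ hX hG
    refine mem_gammaPt_of_prolongs h hr (by simp) ht.pt hW hQ (fun g hS => hloc ▸ hS)
      (fun x => ?_) fun g => (h2 g).trans (hDm.γ_mono (hσ _))
    rw [show t.1.sink.st = _ from hst]
    exact hDm.γ_mono (hσ _) (h1 x)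
  | create x u₁ =>
    obtain ⟨hW, hQ, hσ⟩ := hc
    refine mem_gammaPt_of_prolongs h hr (by simp) ht.pt hW hQ (fun g hS => hloc ▸ hS)
      (fun y => ?_) fun g => ?_
    · obtain ⟨i, -, hi⟩ := hst
      have hx := hcreate x u₁ rfl
      rw [hi, Function.update_self] at hx
      rw [hi, hx]
      refine hDm.γ_mono (hσ _) (mem_update_of_mem hX ?_ y)
      exact hDm.νs_spec _ _ _ _ _ _ _ h.cfg_edge ht.pt
    · exact (hG g).trans (hDm.γ_mono (le_trans (Function.update_of_ne (by simp) _ _).ge (hσ _)))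
  | lock a =>
    obtain ⟨hW, hQ, hσ⟩ := hc
    refine mem_gammaPt_of_prolongs h hr (by simp) ht.pt hW hQ (fun g hS => ?_)
      (fun x => ?_) fun g => (hG g).trans (hDm.γ_mono (hσ _))
    · exact UpLocks.mem_sets_of_subset (hloc ▸ Set.subset_union_left) hS
    · rw [show t.1.sink.st = _ from hst]
      exact hDm.γ_mono (hσ _) (hX x)
  | unlock a =>
    obtain ⟨hW, hQ, hσ⟩ := hc
    refine mem_gammaPt_of_prolongs h hr (by simp) ht.pt hW
      (fun g => le_sup_left.trans (hQ g)) (fun g _ => ?_)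
      (fun x => ?_) fun g => (hG g).trans (hDm.γ_mono (hσ _))
    · exact UpLocks.mem_of_le (le_sup_right.trans (hQ g)) (UpLocks.mem_single.2 hloc.ge)
    · rw [show t.1.sink.st = _ from hst]
      exact hDm.γ_mono (hσ _) (hX x)
  | read x g =>
    obtain ⟨hW, hQ, hσ⟩ := hc
    refine mem_gammaPt_of_prolongs h hr (by simp) ht.pt hW hQ (fun g hS => hloc ▸ hS)
      (fun y => ?_) fun g => ?_
    · obtain ⟨d, hd⟩ := hst
      have hx := hread x g rfl
      rw [hd, Function.update_self] at hx
      rw [hd]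
      exact hDm.γ_mono (hσ _) (mem_update_of_mem hX hx y)
    · exact (hG g).trans (hDm.γ_mono (le_trans (Function.update_of_ne (by simp) _ _).ge (hσ _)))
  | write g x =>
    obtain ⟨hW, hQ, hσ⟩ := hc
    change Function.update (ptVal η₃ t₀.loc t₀.locks).1 g (.single t₀.locks) ≤ _ at hW
    change Function.update (ptVal η₃ t₀.loc t₀.locks).2.1 g (.single t₀.locks) ≤ _ at hQ
    change Function.update (ptVal η₃ t₀.loc t₀.locks).2.2 (.inr g)
      ((ptVal η₃ t₀.loc t₀.locks).2.2 (.inl x)) ≤ _ at hσ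
    have hne : ∀ {k}, k ≠ g → ∀ y, Act.write g x ≠ (.write k y : Act X G M N R) := by
      rintro k hk y hy
      simp only [Act.write.injEq] at hy
      exact hk hy.1.symm
    refine ⟨⟨hr, rfl⟩, rfl, fun k => ?_, fun k => ?_, ?_⟩
    · refine le_trans ?_ (hW k)
      by_cases hk : k = g
      · subst hk
        rw [betaW_le]
        intro v y v' hl
        obtain ⟨-, -, rfl⟩ := h.lastTlWrite_write hl
        rw [Function.update_self]
        exact UpLocks.mem_single.2 hloc.ge
      · simpa [hk] using h.betaW_le (hne hk) (ht.pt.2.2.1 k)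
    · refine le_trans ?_ (hQ k)
      by_cases hk : k = g
      · subst hk
        rw [betaP_le]
        refine ⟨fun hn => absurd h.id_eq.symm (hn _ _ _ h.edge), fun v y v' hl n hn hs hi => ?_⟩
        obtain ⟨-, -, rfl⟩ := h.lastTlWrite_write hl
        -- The write enters the sink, so the history since the write is the sink alone.
        obtain rfl := t.raw.node_ext hn t.2.2.1 hs (le_antisymm (t.idx_le_sink hn hs) hi)
        rw [Function.update_self]
        exact UpLocks.mem_single.2 hloc.ge
      · simpa [hk] using h.betaP_le (hne hk) (ht.pt.2.2.2.1 k) fun hS => hloc ▸ hS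
    · rintro (y | k)
      · rintro _ rfl
        rw [show t.1.sink.st = _ from hst]
        exact hDm.γ_mono (le_trans (Function.update_of_ne (by simp) _ _).ge (hσ _)) (hX y)
      · refine Set.Subset.trans ?_ (hDm.γ_mono (hσ _))
        by_cases hk : k = g
        · subst hk
          rintro _ ⟨v, y, v', hl, rfl⟩
          obtain ⟨rfl, rfl, -⟩ := h.lastTlWrite_write hl
          simpa using hX y
        · rw [h.betaVal_inr (hne hk)]
          simpa [hk] using hG k

/-- The invariant: the trace is finite, and it is described by `η₃`, as are subtraces ending at
arbitrary nodes. -/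
structure IsSoundTrace (ν : LocalTrace P → P.tids) (Dm : AbsDomain X G V M N R D)
    (η₃ : ∀ x, AbsVal X G M N D x) (t : LocalTrace P) : Prop where
  finite : t.1.nodes.Finite
  described : IsDescribed ν Dm η₃ t
  sub : ∀ n ∈ t.1.nodes, ∃ t' : LocalTrace P, t'.1.IsSub t.1 ∧ t'.1.sink = n ∧
    IsDescribed ν Dm η₃ t'

theorem IsSoundTrace.reachable (h : IsSoundTrace ν Dm η₃ t) : Reachable ν t := h.described.pt.1.1

/-- The value read is described by the value of the right-hand side. -/
theorem read_mem [Finite M] (hP : P.WellFormed) (hγ : Monotone Dm.γ)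
    (ht : IsSoundTrace ν Dm η₃ t₀) {x g u' σ'} (h : t.1 = t₀.1.extend (.read x g) u' σ') :
    t.1.sink.st x ∈ Dm.γ (readVal η₃ t₀.loc t₀.locks g) := by
  obtain ⟨o, hg⟩ := t.2.1
  have he : (t₀.1.sink, Act.read x g, t.1.sink) ∈ t.1.edges := by
    rw [h]; exact Set.mem_insert _ _
  have hedges : ∀ {z y z'}, (z, Act.write g y, z') ∈ t.1.edges ↔
      (z, Act.write g y, z') ∈ t₀.1.edges := by
    intro z y z'; rw [h]; simp [extend]
  have hLe : ∀ {v v'}, t₀.1.Le v v' → t.1.Le v v' := by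
    intro v v' hv
    refine Relation.ReflTransGen.mono ?_ _ _ hv
    rintro a b (⟨A, e⟩ | hs)
    · exact Or.inl ⟨A, by rw [h]; exact Set.mem_insert_of_mem _ e⟩
    · exact Or.inr (by rw [h]; exact hs)
  obtain ⟨z, y, z', ew, -, hmax, hval⟩ := hg.globals _ _ _ _ he
  rw [hedges] at ew
  -- The read starts at the sink of `t₀`, above all writes in `t₀`, so the maximality of `z'` holds
  -- among all of them.
  have hmax' : ∀ z₂ y₂ z₂', (z₂, Act.write g y₂, z₂') ∈ t₀.1.edges → t₀.1.Le z' z₂' → z₂' = z' :=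
    fun z₂ y₂ z₂' e hle => hmax z₂ y₂ z₂' (hedges.2 e)
      (hLe (t₀.2.2.2 _ (t₀.raw.edge_mem e).2.1)) (hLe hle)
  have hz := t₀.raw.edge_mem ew
  have hlast : ∀ z₂ y₂ z₂', (z₂, Act.write g y₂, z₂') ∈ t₀.1.edges →
      z₂.st P.self = z.st P.self → z₂'.idx ≤ z'.idx := by
    intro z₂ y₂ z₂' e hs
    by_contra hc
    have h2 := t₀.raw.edge_mem e
    have hs' : z'.st P.self = z₂'.st P.self := by rw [hz.2.2.2.1, h2.2.2.2.1, hs]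
    rw [hmax' _ _ _ e (t₀.raw.le_of_idx_le hz.2.1 h2.2.1 hs' (by omega))] at hc
    exact hc le_rfl
  rw [hval]
  by_cases hego : z.st P.self = t₀.id
  · refine hγ le_sup_left (ht.described.pt.2.2.2.2 (.inr g) ⟨z, y, z', ⟨ew, hego, ?_⟩, rfl⟩)
    rw [← hego]
    exact hlast
  · obtain ⟨a, ha, r₀, r, er, hrs, hri, hdisj, hP'⟩ := exists_unlock_of_foreign_write hP ht.finite
      (t.raw.edge_mem he).2.2.2.2.1 (Or.inl ⟨x, rfl⟩) ew hmax' hego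
    -- The subtrace ending at the release contains the write, which is also the last one of its ego
    -- thread; its description bounds the value by a side-effect of the `unlock`.
    obtain ⟨t', hsub, rfl, hd⟩ := ht.sub r (t₀.raw.edge_mem er).2.1
    have hid : t'.id = z.st P.self := hrs
    have hz' : z' ∈ t'.1.nodes := hsub.mem_nodes t'.raw t₀.raw hz.2.1 t'.2.2.1
      (hz.2.2.2.1.trans hrs.symm) hri.le
    have hwl : t'.LastTlWrite g z y z' := by
      refine ⟨hsub.mem_edges t'.raw t₀.raw ew hz', hid.symm, fun z₂ y₂ z₂' e hs => ?_⟩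
      exact hlast z₂ y₂ z₂' (hsub.edges e) (hs.trans hid)
    obtain ⟨w, hw, hmem⟩ := hd.glob a g z y z' ⟨r₀, hsub.mem_edges t'.raw t₀.raw er t'.2.2.1⟩ hwl
    rw [← hsub.lockset_eq t'.raw t₀.raw hz'] at hw
    have hQ := betaP_le.1 (ht.described.pt.2.2.2.1 g)
    -- Without an ego write, `∅` lies in `P g` and satisfies both conditions trivially.
    have key : (∃ L ∈ ((ptVal η₃ t₀.loc t₀.locks).2.1 g).sets, L ∩ t₀.1.lockset z' = ∅) ∧
        ∃ L ∈ ((ptVal η₃ t₀.loc t₀.locks).2.1 g).sets, a ∉ L := by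
      rcases noTlWrite_or_exists_last ht.finite g with hn | ⟨v, x, v', hl⟩
      · exact ⟨⟨∅, hQ.1 hn, Set.empty_inter _⟩, ∅, hQ.1 hn, Set.notMem_empty a⟩
      · obtain ⟨⟨n, hn, hs, hi, hnz⟩, m, hm, hms, hmi, hma⟩ := hP' v x v' hl
        exact ⟨⟨_, hQ.2 v x v' hl n hn hs hi, hnz⟩, _, hQ.2 v x v' hl m hm hms hmi, hma⟩
    obtain ⟨⟨L, hL, hLz⟩, L', hL', haL'⟩ := key
    obtain ⟨T, hT, hTL⟩ := UpLocks.exists_mins_subset hL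
    obtain ⟨T', hT', hTL'⟩ := UpLocks.exists_mins_subset hL'
    refine hγ (le_trans (le_sSup ?_) le_sup_right) hmem
    refine ⟨a, t'.locks, w, ha, ?_, ⟨T, hT, ?_⟩, ⟨T', hT', fun h => haL' (hTL' h)⟩, rfl⟩
    · rw [← hdisj, hsub.lockset_eq t'.raw t₀.raw t'.2.2.1]; rfl
    · exact Set.subset_eq_empty (Set.inter_subset_inter hTL hw) hLz

/-! ### Preservation of the invariant by the concrete constraints -/

theorem isSoundTrace_init (hDm : Dm.Admissible ν) (hη₃ : IsSolution (absSystem P Dm) η₃)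
    (ht : t ∈ init P) : IsSoundTrace ν Dm η₃ t := by
  have hr : Reachable ν t := .init ht
  obtain ⟨σ, -, h⟩ := ht
  have hpt : t.loc = P.u₀ := by rw [loc, h]; rfl
  have hd : IsDescribed ν Dm η₃ t := by
    obtain ⟨-, hQ, hσ⟩ := (hη₃ _ (Or.inl rfl)).2
    refine isDescribed_of_idx_zero (by rw [h]; rfl) hr (fun g => ?_) fun x => ?_
    · rw [hpt]
      exact UpLocks.mem_of_le (hQ g) (UpLocks.mem_single.2 subset_rfl)
    · rw [hpt]
      refine hDm.γ_mono (hσ (.inl x)) ?_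
      exact hDm.γ_top.symm ▸ Set.mem_univ _
  refine ⟨by rw [h]; exact Set.finite_singleton _, hd, fun n hn => ⟨t, .refl _, ?_, hd⟩⟩
  rw [h] at hn ⊢
  exact (Set.mem_singleton_iff.1 hn).symm

theorem isSoundTrace_new (hDm : Dm.Admissible ν) (hη₃ : IsSolution (absSystem P Dm) η₃)
    (ht : IsSoundTrace ν Dm η₃ t₀) {x u₁ u'} (he : (t₀.loc, Act.create x u₁, u') ∈ P.edges)
    (hn : t ∈ new ν u₁ t₀) : IsSoundTrace ν Dm η₃ t := by
  have hr : Reachable ν t := .new ht.reachable hn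
  obtain ⟨-, h⟩ := hn
  have hpt : t.loc = u₁ := by rw [loc, h]; rfl
  have hsub : t₀.1.IsSub t.1 := by
    rw [h]; exact ⟨Set.subset_insert _ _, subset_rfl⟩
  have hd : IsDescribed ν Dm η₃ t := by
    -- The side-effect is a supremum over the proposition that its target is `[u₁, ∅]`; here that
    -- proposition holds.
    have hc : _ ≤ ptVal η₃ u₁ ∅ := le_trans (le_iSup_of_le ⟨rfl, rfl⟩ le_rfl)
      ((absSystem_edge hη₃ he t₀.locks).1 (.pt u₁ ∅))
    obtain ⟨-, hQ, hσ⟩ := hc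
    refine isDescribed_of_idx_zero (by rw [h]; rfl) hr (fun g => ?_) fun y => ?_
    · rw [hpt]
      exact UpLocks.mem_of_le (hQ g) (UpLocks.mem_single.2 subset_rfl)
    · rw [hpt]
      refine hDm.γ_mono (hσ (.inl y)) ?_
      rw [h]
      by_cases hy : y = P.self
      · subst hy
        simpa [extendNew] using! hDm.νs_spec _ _ _ _ _ _ _ he ht.described.pt
      · simpa [extendNew, hy] using! ht.described.pt.2.2.2.2 (.inl y) rfl
  refine ⟨by rw [h]; exact ht.finite.insert _, hd, fun n hn => ?_⟩
  have hn' : n = t.1.sink ∨ n ∈ t₀.1.nodes := by rw [h] at hn ⊢; exact hn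
  rcases hn' with rfl | hn'
  · exact ⟨t, .refl _, rfl, hd⟩
  · obtain ⟨t', hs, hsink, hd'⟩ := ht.sub n hn'
    exact ⟨t', hs.trans hsub, hsink, hd'⟩

theorem isSoundTrace_sem [Finite M] (hP : P.WellFormed) (hDm : Dm.Admissible ν)
    (hη₃ : IsSolution (absSystem P Dm) η₃) (ht : IsSoundTrace ν Dm η₃ t₀) {u A u'}
    (he : (u, A, u') ∈ P.edges) (hA : ∀ a, A ≠ .lock a) (hs : t ∈ sem ν u A u' t₀) :
    IsSoundTrace ν Dm η₃ t ∧ t.loc = u' ∧ t.LastIs A := by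
  have hr : Reachable ν t := .step he hA ht.reachable hs
  obtain ⟨-, σ', h, hν⟩ := hs
  have hp : Prolongs t₀ A t := by
    refine ⟨⟨?_, ?_⟩, ?_⟩ <;> rw [h]
    · exact Set.subset_insert _ _
    · exact Set.subset_insert _ _
    · exact Set.mem_insert _ _
  have hd : IsDescribed ν Dm η₃ t := by
    refine ⟨pt_of_prolongs hDm hη₃ hp hr ht.described ?_ ?_,
      fun a g v x v' => glob_of_prolongs hDm.γ_mono hη₃ hp ht.described⟩
    · intro x u₁ hx
      rw [h]
      exact hν x u₁ hx
    · rintro x g rfl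
      exact read_mem hP hDm.γ_mono ht h
  refine ⟨⟨by rw [h]; exact ht.finite.insert _, hd, fun n hn => ?_⟩, by rw [loc, h]; rfl,
    _, hp.edge⟩
  have hn' : n = t.1.sink ∨ n ∈ t₀.1.nodes := by rw [h] at hn ⊢; exact hn
  rcases hn' with rfl | hn'
  · exact ⟨t, .refl _, rfl, hd⟩
  · obtain ⟨t', hs, hsink, hd'⟩ := ht.sub n hn'
    exact ⟨t', hs.trans hp.sub, hsink, hd'⟩

/-- The description of the result depends only on `t₀`. The merged trace `t₁` matters only for the
clause on subtraces, to which it passes on its own. -/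
theorem isSoundTrace_semLock [Finite M] (hDm : Dm.Admissible ν)
    (hη₃ : IsSolution (absSystem P Dm) η₃) {t₁ : LocalTrace P} (ht : IsSoundTrace ν Dm η₃ t₀)
    (ht₁ : IsSoundTrace ν Dm η₃ t₁) {u a u'} (he : (u, Act.lock a, u') ∈ P.edges)
    (hs : t ∈ semLock u a u' t₀ t₁) : IsSoundTrace ν Dm η₃ t ∧ t.loc = u' := by
  have hr : Reachable ν t := .lock he ht.reachable ht₁.reachable hs
  obtain ⟨-, -, h⟩ := hs
  have hp : Prolongs t₀ (.lock a) t := by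
    refine ⟨⟨?_, ?_⟩, ?_⟩ <;> rw [h]
    · exact Set.subset_union_left.trans (Set.subset_insert _ _)
    · exact Set.subset_union_left.trans (Set.subset_insert _ _)
    · exact Set.mem_insert _ _
  have hsub₁ : t₁.1.IsSub t.1 := by
    rw [h]
    exact ⟨Set.subset_union_right.trans (Set.subset_insert _ _),
      Set.subset_union_right.trans (Set.subset_insert _ _)⟩
  have hd : IsDescribed ν Dm η₃ t :=
    ⟨pt_of_prolongs hDm hη₃ hp hr ht.described (by simp) (by simp),
      fun a g v x v' => glob_of_prolongs hDm.γ_mono hη₃ hp ht.described⟩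
  refine ⟨⟨by rw [h]; exact (ht.finite.union ht₁.finite).insert _, hd, fun n hn => ?_⟩,
    by rw [loc, h]; rfl⟩
  have hn' : n = t.1.sink ∨ n ∈ t₀.1.nodes ∨ n ∈ t₁.1.nodes := by rw [h] at hn ⊢; exact hn
  rcases hn' with rfl | hn' | hn'
  · exact ⟨t, .refl _, rfl, hd⟩
  · obtain ⟨t', hs, hsink, hd'⟩ := ht.sub n hn'
    exact ⟨t', hs.trans hp.sub, hsink, hd'⟩
  · obtain ⟨t', hs, hsink, hd'⟩ := ht₁.sub n hn'
    exact ⟨t', hs.trans hsub₁, hsink, hd'⟩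

/-- The sound traces, as an assignment for the concrete constraint system. -/
def soundTraces (ν : LocalTrace P → P.tids) (Dm : AbsDomain X G V M N R D)
    (η₃ : ∀ x, AbsVal X G M N D x) : ConcUnk M N → Set (LocalTrace P)
  | .pt u => {t | IsSoundTrace ν Dm η₃ t ∧ t.loc = u}
  | .mx a => {t | IsSoundTrace ν Dm η₃ t ∧ (t ∈ init P ∨ t.LastIs (.unlock a))}

theorem isSolution_soundTraces [Finite M] (hP : P.WellFormed) (hDm : Dm.Admissible ν)
    (hη₃ : IsSolution (absSystem P Dm) η₃) :
    IsSolution (concSystem ν) (soundTraces ν Dm η₃) := by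
  rintro c ((rfl | ⟨a, rfl⟩) | ⟨u, A, u', he, rfl⟩)
  · refine ⟨fun _ => Set.empty_subset _, fun t ht => ⟨isSoundTrace_init hDm hη₃ ht, ?_⟩⟩
    obtain ⟨σ, -, h⟩ := ht
    rw [loc, h]; rfl
  · exact ⟨fun _ => Set.empty_subset _, fun t ht => ⟨isSoundTrace_init hDm hη₃ ht, Or.inl ht⟩⟩
  · have hsem : (∀ a, A ≠ .lock a) → ∀ t, (∃ t₀ ∈ soundTraces ν Dm η₃ (.pt u),
        t ∈ sem ν u A u' t₀) → IsSoundTrace ν Dm η₃ t ∧ t.loc = u' ∧ t.LastIs A :=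
      fun hA t ⟨t₀, ht₀, hs⟩ => isSoundTrace_sem hP hDm hη₃ ht₀.1 he hA hs
    cases A with
    | create x u₁ =>
      refine ⟨?_, fun t ht => ⟨(hsem (by simp) t ht).1, (hsem (by simp) t ht).2.1⟩⟩
      rintro (v | b)
      · rintro t ⟨rfl, t₀, ⟨ht₀, rfl⟩, hn⟩
        refine ⟨isSoundTrace_new hDm hη₃ ht₀ he hn, ?_⟩
        rw [loc, hn.2]; rfl
      · exact Set.empty_subset _
    | lock a =>
      refine ⟨fun _ => Set.empty_subset _, ?_⟩
      rintro t ⟨t₀, ht₀, t₁, ht₁, hs⟩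
      exact isSoundTrace_semLock hDm hη₃ ht₀.1 ht₁.1 he hs
    | unlock a =>
      refine ⟨?_, fun t ht => ⟨(hsem (by simp) t ht).1, (hsem (by simp) t ht).2.1⟩⟩
      rintro (v | b)
      · exact Set.empty_subset _
      · rintro t ⟨rfl, ht⟩
        exact ⟨(hsem (by simp) t ht).1, Or.inr (hsem (by simp) t ht).2.2⟩
    | _ =>
      exact ⟨fun _ => Set.empty_subset _,
        fun t ht => ⟨(hsem (by simp) t ht).1, (hsem (by simp) t ht).2.1⟩⟩

end Soundness

/-! ### Soundness of every post-solution -/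

theorem theorem6 {X G V M N R D : Type u} [DecidableEq X] [DecidableEq G] [Finite M]
    [CompleteLattice D]
    (P : Program X G V M N R) (hP : P.WellFormed) (ν : LocalTrace P → P.tids)
    (Dm : AbsDomain X G V M N R D) (hDm : Dm.Admissible ν)
    (η : ConcUnk M N → Set (LocalTrace P))
    (hη : IsLeast {η : ConcUnk M N → Set (LocalTrace P) | IsSolution (concSystem ν) η} η)
    (η₃ : ∀ x, AbsVal X G M N D x) (hη₃ : IsSolution (absSystem P Dm) η₃) :
    (∀ u S, splitPt η u S ⊆ gammaPt ν Dm.γ u S (η₃ (.pt u S))) ∧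
    (∀ g a S w, splitGlob η g a S w ⊆
      gammaGlob ν Dm.γ g a S w (⨆ w' ⊆ w, (η₃ (.glob g a S w') : D))) := by
  -- Only the leastness of `η` is needed, as the sound traces form a post-solution.
  have hle : η ≤ soundTraces ν Dm η₃ := hη.2 (isSolution_soundTraces hP hDm hη₃)
  constructor
  · rintro u S t ⟨ht, rfl⟩
    obtain ⟨hs, rfl⟩ := hle (.pt u) ht
    exact hs.described.pt
  · rintro g a S w t ⟨ht, rfl, hw⟩
    obtain ⟨hs, hlast⟩ := hle (.mx a) ht
    refine ⟨hs.described.pt.1, hlast, hw.imp_left ?_⟩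
    rintro ⟨v, x, v', hl, hvw⟩
    rcases hlast with ⟨σ, -, h⟩ | hlast
    -- An initial trace has no edges, hence no write.
    · exact absurd (h ▸ hl.1) (Set.notMem_empty _)
    · obtain ⟨w', hw', hmem⟩ := hs.described.glob a g v x v' hlast hl
      have hw : w' ⊆ w := hw'.trans hvw
      exact ⟨v, x, v', hl, hDm.γ_mono (le_iSup₂_of_le w' hw le_rfl) hmem, hvw⟩
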